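/- A ballot path is a lattice path from $(0,0)$ with steps $u=(0,1)$ and $r=(1,0)$ staying weakly above $y=x$; for a pattern $p\in\{u,r\}^*$ let $D(n,m)$ be the number of ballot paths to $(n,m)$ that do not contain $p$ as a consecutive substring. The bifix index of $p$ is the number of nonempty proper prefixes of $p$ that are also suffixes; the depth of $p$ is the maximum, over all (possibly empty) suffixes, of the number of $u$'s minus the number of $r$'s. Let $E^v f(x)=f(x+v)$ on real polynomials. A delta operator $B$ is a shift-invariant linear operator with $Bx$ a nonzero constant; a Sheffer sequence for $B$ is a sequence of polynomials with $\deg s_n=n$, $Bs_n=s_{n-1}$ ($s_{-1}=0$); the basic sequence $(b_n)$ of $B$ is the Sheffer sequence for $B$ with $b_n(0)=\delta_{0,n}$. Let $p$ have depth $\delta\ge 1$, bifix index $0$ or $1$, and contain $a\ge 2$ letters $r$ and $c\le a$ letters $u$. If the bifix index is $1$, write $p=op'o$ with $o$ the bifix, let $op'$ contain $b$ letters $r$ and $d$ letters $u$, and assume $b\ge d$. Then there are a delta operator $B$ with basic sequence $(b_n)$ and a Sheffer sequence $(s_n)$ for $B$ such that $D(n,m)=s_n(m)$ whenever $m\ge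 n+\delta$. Moreover, for all such $B$, $(b_n)$, $(s_n)$: 1. $1-B-E^{-1}=-B^aE^{-c}$ if the bifix index is $0$, and $(1-B-E^{-1})(1+B^bE^{-d})=-B^aE^{-c}$ if it is $1$. 2. For an integer $x\ge 0$, the equality $D(n,n+x)=s_n(n+x)$ holds for all $n\ge 0$ if and only if $x\ge\delta-1$. 3. With $B_1=E^{-1}B$, for all $n\ge0$, as polynomials in $x$, $$s_n(n+x)=\sum_{j\ge 0}(-1)^j\Bigl(\sum_{i=1}^{\lfloor(\delta+1)/2\rfloor}\Bigl(\tbinom{\delta-i}{i}+E^1\tbinom{\delta-i}{i-1}\Bigr)(-1)^iB_1^i\Bigr)^j\,\frac{x+1-\delta}{n+x+1-\delta}\,b_n(n+x+1-\delta),$$ where the terms with $j>n$ vanish and the last factor, to which the operators are applied, is a polynomial in $x$ (equal to $1$ for $n=0$). Furthermore $B_1^k$ maps $\frac{x+1-\delta}{n+x+1-\delta}b_n(n+x+1-\delta)$ to $\frac{x+1-\delta}{n-k+x+1-\delta}b_{n-k}(n-k+x+1-\delta)$ for $k\le n$ and to $0$ for $k>n$. The pattern $rrruuurrruu$ satisfies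 these assumptions with $\delta=2$, and for it, as polynomials in $x$, $$s_n(n+x)=\sum_{j\ge0}(1+E^1)^jB_1^j\,\frac{x-1}{n+x-1}b_n(n+x-1)=2^n+\sum_{j=1}^{n}\sum_{i=0}^{n-j}\binom{n-j}{i}\frac{x+i-1}{j+x+i-1}\,b_j(j+x+i-1).$$ -/

import Mathlib

namespace BallotPath

open Polynomial

/-! ### Patterns and ballot paths -/

/-- The two steps: `u` (up) and `r` (right). -/
inductive Step
  | u
  | r
  deriving DecidableEq

instance : Fintype Step := ⟨{Step.u, Step.r}, fun x => by cases x <;> simp⟩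

/-- The number of right steps of a path. -/
def numR (p : List Step) : ℕ := p.count Step.r

/-- The number of up steps of a path. -/
def numU (p : List Step) : ℕ := p.count Step.u

/-- `d(p)`: the number of up steps minus the number of right steps. -/
def height (p : List Step) : ℤ := (numU p : ℤ) - (numR p : ℤ)

/-- The depth of a pattern: the maximum of `d(p')` over all suffixes `p'` of `p` (the empty suffix,
with `d = 0`, included); see `isGreatest_depth`. -/
def depth (p : List Step) : ℕ := ((p.tails.map height).foldr max 0).toNat

theorem isGreatest_depth (p : List Step) :
    IsGreatest {k : ℤ | ∃ q, q <:+ p ∧ height q = k} (depth p : ℤ) := by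
  have key : ∀ p : List Step, IsGreatest {k : ℤ | ∃ q, q <:+ p ∧ height q = k}
      ((p.tails.map height).foldr max 0) := by
    intro p
    induction p with
    | nil =>
      refine ⟨⟨[], List.suffix_refl _, by simp [height, numU, numR]⟩, ?_⟩
      rintro k ⟨q, hq, rfl⟩
      have : q = [] := List.suffix_nil.mp hq
      subst this
      simp [height, numU, numR]
    | cons x l ih =>
      have e : ((x :: l).tails.map height).foldr max 0
          = max (height (x :: l)) ((l.tails.map height).foldr max 0) := by simp
      rw [e]
      constructor
      · rcases max_choice (height (x :: l)) ((l.tails.map height).foldr max 0) with h | h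
        · rw [h]; exact ⟨_, List.suffix_refl _, rfl⟩
        · rw [h]
          obtain ⟨q, hq, hk⟩ := ih.1
          exact ⟨q, hq.trans (List.suffix_cons _ _), hk⟩
      · rintro k ⟨q, hq, rfl⟩
        rcases List.suffix_cons_iff.mp hq with h | h
        · subst h; exact le_max_left _ _
        · exact le_max_of_le_right (ih.2 ⟨q, h, rfl⟩)
  have h := key p
  have h0 : 0 ≤ (p.tails.map height).foldr max 0 :=
    h.2 ⟨[], List.nil_suffix, by simp [height, numU, numR]⟩
  rw [depth, Int.toNat_of_nonneg h0]
  exact h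

/-- The nonempty proper bifixes of `p`. -/
def bifixes (p : List Step) : Set (List Step) :=
  {o | o ≠ [] ∧ o ≠ p ∧ o <+: p ∧ o <:+ p}

/-- The bifix index of `p`: its number of nonempty proper bifixes. -/
noncomputable def bifixIndex (p : List Step) : ℕ := (bifixes p).ncard

/-- The paths from `(0,0)` to `(n,m)` with steps `u`, `r` that stay weakly above `y = x`
and avoid `p` (do not contain `p` as a string of consecutive steps). -/
def paths (p : List Step) (n m : ℕ) : Set (List Step) :=
  {w | numR w = n ∧ numU w = m ∧ (∀ q, q <+: w → numR q ≤ numU q) ∧ ¬ p <:+: w}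

theorem numR_add_numU (w : List Step) : numR w + numU w = w.length := by
  induction w with
  | nil => rfl
  | cons x l ih => cases x <;> simp [numR, numU] at ih ⊢ <;> omega

theorem paths_finite (p : List Step) (n m : ℕ) : (paths p n m).Finite := by
  refine (List.finite_length_eq Step (n + m)).subset ?_
  rintro w ⟨h1, h2, -⟩
  have := numR_add_numU w
  change w.length = n + m
  omega

/-- `D(n,m)`: the number of ballot paths to `(n,m)` avoiding `p`. -/
noncomputable def D (p : List Step) (n m : ℕ) : ℕ := (paths p n m).ncard

/-- The patterns under consideration: depth at least `1`, bifix index `0` or `1`,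
`2 ≤ a` and `c ≤ a` for the dimensions `a × c` of `p`, and `d ≤ b` for the dimensions `b × d` of
`op'` when `p = op'o` with a nonempty bifix `o`. -/
structure Admissible (p : List Step) : Prop where
  one_le_depth : 1 ≤ depth p
  bifixIndex_le : bifixIndex p = 0 ∨ bifixIndex p = 1
  two_le_numR : 2 ≤ numR p
  numU_le_numR : numU p ≤ numR p
  bifix_dim : ∀ o p' : List Step, o ≠ [] → p = o ++ p' ++ o → numU (o ++ p') ≤ numR (o ++ p')

/-! ### Operators on polynomials -/

/-- Linear operators on real polynomials; multiplication is composition. -/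
abbrev Op := Module.End ℝ ℝ[X]

/-- The shift `E^v : f(x) ↦ f(x + v)`. -/
noncomputable def E (v : ℝ) : Op where
  toFun f := f.comp (X + C v)
  map_add' _ _ := add_comp
  map_smul' _ _ := smul_comp _ _ _

/-- A delta operator: a linear operator that commutes with all shifts and maps `x` to a nonzero
constant. -/
def IsDelta (B : Op) : Prop :=
  (∀ v : ℝ, B * E v = E v * B) ∧ ∃ k : ℝ, k ≠ 0 ∧ B X = C k

/-- A Sheffer sequence for `B`: `deg s_n = n` and `B s_n = s_{n-1}` (with `s_{-1} = 0`). -/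
def IsSheffer (B : Op) (s : ℕ → ℝ[X]) : Prop :=
  (∀ n : ℕ, (s n).degree = n) ∧ B (s 0) = 0 ∧ ∀ n : ℕ, B (s (n + 1)) = s n

/-- The basic sequence of `B`: the Sheffer sequence for `B` with `b_n(0) = δ_{0,n}`. -/
def IsBasic (B : Op) (b : ℕ → ℝ[X]) : Prop :=
  IsSheffer B b ∧ ∀ n : ℕ, (b n).eval 0 = if n = 0 then 1 else 0

/-- The polynomial `((x + v) / (n + x + v)) * b_n(n + x + v)` in `x`. The division is exact when
`b` is a basic sequence, see `mul_abel`; in particular the polynomial is `1` for `n = 0`. -/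
noncomputable def abel (b : ℕ → ℝ[X]) (n : ℕ) (v : ℝ) : ℝ[X] :=
  ((X + C v) * (b n).comp (X + C ((n : ℝ) + v))) /ₘ (X + C ((n : ℝ) + v))

theorem mul_abel {B : Op} {b : ℕ → ℝ[X]} (hb : IsBasic B b) (n : ℕ) (v : ℝ) :
    (X + C ((n : ℝ) + v)) * abel b n v = (X + C v) * (b n).comp (X + C ((n : ℝ) + v)) := by
  unfold abel
  have hdvd : (X + C ((n : ℝ) + v)) ∣ (X + C v) * (b n).comp (X + C ((n : ℝ) + v)) := by
    have hX : (X + C ((n : ℝ) + v) : ℝ[X]) = X - C (-((n : ℝ) + v)) := by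
      rw [C_neg, sub_neg_eq_add]
    rw [hX, dvd_iff_isRoot, IsRoot, eval_mul, ← hX, eval_comp]
    rcases Nat.eq_zero_or_pos n with h | h
    · subst h; simp
    · have := hb.2 n
      rw [if_neg h.ne'] at this
      simp [this]
  have h := modByMonic_add_div ((X + C v) * (b n).comp (X + C ((n : ℝ) + v)))
    (X + C ((n : ℝ) + v))
  rwa [(modByMonic_eq_zero_iff_dvd (monic_X_add_C _)).2 hdvd, zero_add] at h

/-- `B₁ = E^{-1} B`, the delta operator of the Sheffer sequence `s_n(n + x)`. -/
noncomputable def B₁ (B : Op) : Op := E (-1) * B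

/-- The operator
`∑_{i=1}^{⌊(δ+1)/2⌋} (C(δ-i, i) + C(δ-i, i-1) E^1) (-1)^i B₁^i`. -/
noncomputable def corr (B : Op) (δ : ℕ) : Op :=
  ∑ i ∈ Finset.Icc 1 ((δ + 1) / 2),
    (((δ - i).choose i : ℝ) • (1 : Op) + ((δ - i).choose (i - 1) : ℝ) • E 1)
      * ((-1 : ℝ) ^ i • B₁ B ^ i)

/-- `s` is a Sheffer sequence for the delta operator `B`, with basic sequence `b`, that counts the
ballot paths avoiding `p` at all points weakly above the line `y = x + depth p`. -/
def IsCountedBy (p : List Step) (B : Op) (b s : ℕ → ℝ[X]) : Prop :=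
  IsDelta B ∧ IsBasic B b ∧ IsSheffer B s ∧
    ∀ n m : ℕ, n + depth p ≤ m → (D p n m : ℝ) = (s n).eval (m : ℝ)

/-- The pattern `rrruuurrruu`. -/
def examplePattern : List Step :=
  [.r, .r, .r, .u, .u, .u, .r, .r, .r, .u, .u]

end BallotPath

namespace BallotPath

open Polynomial

/-! ### Occurrences of a pattern -/

/-! Let `F(n,m)` count the ballot paths to `(n,m)` whose only occurrence of `p` is at the end.
Deleting the last step gives `D(n,m) + F(n,m) = D(n-1,m) + D(n,m-1)`. Attaching `p` to an avoiding
path gives, once the endpoint has height at least `δ`, `F(n+a,m+c) = D(n,m)`, with a correction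
`F(n+a-b,m+c-d)` when there is one bifix. `IsPatternCount` retains only these facts; everything
afterwards is algebra.

Existence: the recursions make `D(n,·)` a polynomial of degree `n` far enough up
(`IsPatternCount.exists_poly`). This sequence defines `B`, and the functional equation itself forces
`B` to commute with `E^{-1}` (`IsPatternCount.map_shift_neg_one`), hence with all shifts.

Operator equation: `defect B = B + E^{-1} - 1` sends `s_n` to the polynomial that gives `F(n,·)`, so
the relation between `F` and `D` is an identity of operators. Comparing the two recursions just
below height `δ`, where `F` vanishes but the defect of `s_a` is `1`, shows that agreement stops
exactly at height `δ - 1`.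

Expansion: below height `δ` the diagonals satisfy a recursion of Fibonacci type that ends in
`D(n+1,n) = 0`. Solved backwards (`IsPatternCount.one_eq`), it says that `(1 + corr) s_n(n+x)` takes
the value `δ_{0,n}` at `x = δ - 1`. The Abelized basic sequence has the same values there and is
also lowered by `B₁`, so the two coincide; `1 + corr` is inverted by a geometric series, finite
because `corr` is divisible by `B₁`. -/

theorem numR_append (v w : List Step) : numR (v ++ w) = numR v + numR w := List.count_append

theorem numU_append (v w : List Step) : numU (v ++ w) = numU v + numU w := List.count_append

/-- The path stays weakly above the diagonal. -/
def IsBallot (w : List Step) : Prop := ∀ q, q <+: w → numR q ≤ numU q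

theorem IsBallot.of_prefix {v w : List Step} (hw : IsBallot w) (h : v <+: w) : IsBallot v :=
  fun q hq => hw q (hq.trans h)

theorem isBallot_append_iff {v w : List Step} :
    IsBallot (v ++ w) ↔ IsBallot v ∧ ∀ q, q <+: w → numR (v ++ q) ≤ numU (v ++ q) := by
  constructor
  · intro h
    exact ⟨h.of_prefix (List.prefix_append _ _),
      fun q hq => h _ ((List.prefix_append_right_inj v).2 hq)⟩
  · rintro ⟨h1, h2⟩ q hq
    obtain ⟨t, ht⟩ := hq
    rcases List.append_eq_append_iff.1 ht with ⟨s, hs, -⟩ | ⟨s, rfl, hs⟩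
    · exact h1 q ⟨s, hs.symm⟩
    · exact h2 s ⟨t, hs.symm⟩

/-- The ballot paths to `(n, m)` that contain `p` as a suffix and nowhere else. -/
def endPaths (p : List Step) (n m : ℕ) : Set (List Step) :=
  {w | numR w = n ∧ numU w = m ∧ IsBallot w ∧ p <:+ w ∧ ∀ x y, w = x ++ p ++ y → y = []}

theorem endPaths_finite (p : List Step) (n m : ℕ) : (endPaths p n m).Finite := by
  refine (List.finite_length_eq Step (n + m)).subset ?_
  rintro w ⟨h1, h2, -⟩
  have := numR_add_numU w
  change w.length = n + m
  omega

/-- The number of ballot paths to `(n, m)` that contain `p` as a suffix and nowhere else. -/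
noncomputable def F (p : List Step) (n m : ℕ) : ℕ := (endPaths p n m).ncard

theorem F_eq_zero_of_lt_numR {p : List Step} {n m : ℕ} (h : n < numR p) : F p n m = 0 := by
  rw [F, Set.ncard_eq_zero (endPaths_finite p n m), Set.eq_empty_iff_forall_notMem]
  rintro w ⟨h1, -, -, ⟨v, rfl⟩, -⟩
  rw [numR_append] at h1
  omega

/-- The suffix of `p` that attains the depth starts weakly above the diagonal, so the path ends at
height at least `depth p`. -/
theorem F_eq_zero_of_lt_depth {p : List Step} {n m : ℕ} (h : m < n + depth p) : F p n m = 0 := by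
  rw [F, Set.ncard_eq_zero (endPaths_finite p n m), Set.eq_empty_iff_forall_notMem]
  rintro w ⟨h1, h2, h3, ⟨v, rfl⟩, -⟩
  obtain ⟨q, ⟨t, rfl⟩, hq⟩ := (isGreatest_depth p).1
  have h4 := h3 (v ++ t) ⟨q, by simp⟩
  simp only [numR_append, numU_append] at h1 h2 h4
  unfold height at hq
  omega

/-- No suffix of `p` climbs more than `depth p`, so from a high enough endpoint one cannot trace
back below the diagonal. -/
theorem IsBallot.append_of_depth {p v : List Step} (hv : IsBallot v)
    (h : numR (v ++ p) + depth p ≤ numU (v ++ p)) : IsBallot (v ++ p) := by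
  refine isBallot_append_iff.2 ⟨hv, ?_⟩
  rintro q ⟨t, rfl⟩
  have := (isGreatest_depth (q ++ t)).2 ⟨t, List.suffix_append _ _, rfl⟩
  simp only [numR_append, numU_append, height] at this h ⊢
  omega

theorem D_zero_left {p : List Step} (hp : 1 ≤ numR p) (m : ℕ) : D p 0 m = 1 := by
  have : paths p 0 m = {List.replicate m Step.u} := by
    ext w
    constructor
    · rintro ⟨h1, h2, -⟩
      have hr : Step.r ∉ w := List.count_eq_zero.1 h1
      refine List.eq_replicate_iff.2 ⟨?_, ?_⟩
      · have := numR_add_numU w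
        omega
      · intro b hb
        cases b
        · rfl
        · exact absurd hb hr
    · rintro rfl
      refine ⟨by simp [numR, List.count_replicate], by simp [numU], ?_, ?_⟩
      · intro q hq
        have : numR q ≤ numR (List.replicate m Step.u) := hq.sublist.count_le _
        have h0 : numR (List.replicate m Step.u) = 0 := by simp [numR, List.count_replicate]
        omega
      · intro hq
        have : numR p ≤ numR (List.replicate m Step.u) := hq.sublist.count_le _
        have h0 : numR (List.replicate m Step.u) = 0 := by simp [numR, List.count_replicate]
        omega
  rw [D, this, Set.ncard_singleton]

theorem D_eq_zero_of_lt {p : List Step} {n m : ℕ} (h : m < n) : D p n m = 0 := by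
  rw [D, Set.ncard_eq_zero (paths_finite p n m), Set.eq_empty_iff_forall_notMem]
  rintro w ⟨h1, h2, h3, -⟩
  have := h3 w (List.prefix_refl w)
  omega

/-- Delete the last step: both kinds of path on the left become avoiding paths. Conversely, a step
appended to an avoiding path can create `p` only at the very end. -/
theorem D_succ_add_F_succ {p : List Step} {n m : ℕ} (h : n ≤ m) :
    D p (n + 1) (m + 1) + F p (n + 1) (m + 1) = D p n (m + 1) + D p (n + 1) m := by
  have hinj : ∀ s : Step, Function.Injective (fun w : List Step => w ++ [s]) :=
    fun s => List.append_left_injective [s]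
  have e : paths p (n + 1) (m + 1) ∪ endPaths p (n + 1) (m + 1) =
      (fun w => w ++ [Step.r]) '' paths p n (m + 1) ∪
        (fun w => w ++ [Step.u]) '' paths p (n + 1) m := by
    ext w
    constructor
    · intro hw
      have key : numR w = n + 1 ∧ numU w = m + 1 ∧ IsBallot w ∧
          ∀ x y, w = x ++ p ++ y → y = [] := by
        rcases hw with ⟨h1, h2, h3, h4⟩ | ⟨h1, h2, h3, -, h4⟩
        · exact ⟨h1, h2, h3, fun x y hxy => absurd ⟨x, y, hxy.symm⟩ h4⟩
        · exact ⟨h1, h2, h3, h4⟩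
      obtain ⟨h1, h2, h3, h4⟩ := key
      rcases List.eq_nil_or_concat' w with rfl | ⟨v, s, rfl⟩
      · simp [numR] at h1
      have hv : ¬ p <:+: v := by
        rintro ⟨x, y, rfl⟩
        have := h4 x (y ++ [s]) (by simp)
        simp at this
      have hb : IsBallot v := h3.of_prefix (List.prefix_append _ _)
      rw [numR_append] at h1
      rw [numU_append] at h2
      cases s
      · right
        exact ⟨v, ⟨by simpa [numR] using h1, by simpa [numU] using h2, hb, hv⟩, rfl⟩
      · left
        exact ⟨v, ⟨by simpa [numR] using h1, by simpa [numU] using h2, hb, hv⟩, rfl⟩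
    · intro hw
      have key : ∃ v s, w = v ++ [s] ∧ numR w = n + 1 ∧ numU w = m + 1 ∧ IsBallot v ∧
          ¬ p <:+: v := by
        rcases hw with ⟨v, ⟨h1, h2, h3, h4⟩, rfl⟩ | ⟨v, ⟨h1, h2, h3, h4⟩, rfl⟩
        · exact ⟨v, _, rfl, by simp [numR_append, h1]; rfl, by simp [numU_append, h2]; rfl, h3, h4⟩
        · exact ⟨v, _, rfl, by simp [numR_append, h1]; rfl, by simp [numU_append, h2]; rfl, h3, h4⟩
      obtain ⟨v, s, rfl, h1, h2, h3, h4⟩ := key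
      have hb : IsBallot (v ++ [s]) := by
        intro q hq
        rcases List.prefix_concat_iff.1 hq with rfl | hq
        · omega
        · exact h3 q hq
      by_cases hs : p <:+: v ++ [s]
      · right
        have hy : ∀ x y, v ++ [s] = x ++ p ++ y → y = [] := by
          intro x y hxy
          rcases List.eq_nil_or_concat' y with rfl | ⟨y', s', rfl⟩
          · rfl
          · rw [← List.append_assoc] at hxy
            exact absurd ⟨x, y', (List.append_inj_left' hxy rfl).symm⟩ h4
        refine ⟨h1, h2, hb, ?_, hy⟩
        obtain ⟨x, y, hxy⟩ := hs
        have := hy x y hxy.symm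
        subst this
        exact ⟨x, by simpa using hxy⟩
      · left
        exact ⟨h1, h2, hb, hs⟩
  have d1 : Disjoint (paths p (n + 1) (m + 1)) (endPaths p (n + 1) (m + 1)) := by
    rw [Set.disjoint_left]
    rintro w ⟨-, -, -, h1⟩ ⟨-, -, -, h2, -⟩
    exact h1 h2.isInfix
  have d2 : Disjoint ((fun w => w ++ [Step.r]) '' paths p n (m + 1))
      ((fun w => w ++ [Step.u]) '' paths p (n + 1) m) := by
    rw [Set.disjoint_left]
    rintro w ⟨v, -, rfl⟩ ⟨v', -, h⟩
    have := (List.append_inj' h rfl).2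
    simp at this
  have := congrArg Set.ncard e
  rwa [Set.ncard_union_eq d1 (paths_finite _ _ _) (endPaths_finite _ _ _),
    Set.ncard_union_eq d2 ((paths_finite _ _ _).image _) ((paths_finite _ _ _).image _),
    Set.ncard_image_of_injective _ (hinj _), Set.ncard_image_of_injective _ (hinj _)] at this

/-- Since `v` avoids `p`, the occurrence must reach into `q`. The part `t` of `q` that it covers is
a prefix of `p` through `q` and a suffix of `p` through the occurrence; `y ≠ []` makes it proper. -/
theorem exists_overlap {p v q x y : List Step} (hq : q <+: p) (h : v ++ q = x ++ p ++ y)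
    (hy : y ≠ []) (hv : ¬ p <:+: v) :
    ∃ t ∈ bifixes p, q = t ++ y ∧ x ++ p = v ++ t := by
  rcases List.append_eq_append_iff.1 h with ⟨t, h1, h2⟩ | ⟨t, h1, h2⟩
  · refine ⟨t, ⟨?_, ?_, ?_, ?_⟩, h2, h1⟩
    · rintro rfl
      exact hv ⟨x, [], by simpa using h1⟩
    · rintro rfl
      have := hq.length_le
      rw [h2, List.length_append] at this
      exact hy (List.length_eq_zero_iff.1 (by omega))
    · exact (h2 ▸ List.prefix_append t y).trans hq
    · refine List.suffix_of_suffix_length_le (h1 ▸ List.suffix_append v t)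
        (List.suffix_append x p) ?_
      have := hq.length_le
      rw [h2, List.length_append] at this
      omega
  · exact absurd ⟨x, t, h1.symm⟩ hv

theorem bifixes_finite (p : List Step) : (bifixes p).Finite := by
  refine (List.finite_toSet p.inits).subset ?_
  rintro o ⟨-, -, h, -⟩
  exact (List.mem_inits _ _).2 h

theorem endPaths_append_avoids {p x z : List Step} (hz : ∀ u y, z = u ++ p ++ y → y = [])
    {t : List Step} (ht : t ≠ []) (h : z = x ++ t) : ¬ p <:+: x := by
  rintro ⟨u, y, rfl⟩
  have := hz u (y ++ t) (by rw [h]; simp)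
  exact ht (List.append_eq_nil_iff.1 this).2

theorem F_add_eq_of_bifixes_eq_empty {p : List Step} (hp : p ≠ []) (h0 : bifixes p = ∅) {n m : ℕ}
    (h : n + numR p + depth p ≤ m + numU p) : F p (n + numR p) (m + numU p) = D p n m := by
  have e : endPaths p (n + numR p) (m + numU p) = (fun v => v ++ p) '' paths p n m := by
    ext w
    constructor
    · rintro ⟨h1, h2, h3, ⟨v, rfl⟩, h5⟩
      rw [numR_append] at h1
      rw [numU_append] at h2
      exact ⟨v, ⟨by omega, by omega, h3.of_prefix (List.prefix_append _ _),
        endPaths_append_avoids h5 hp rfl⟩, rfl⟩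
    · rintro ⟨v, ⟨h1, h2, h3, h4⟩, rfl⟩
      refine ⟨by simp [numR_append, h1], by simp [numU_append, h2],
        IsBallot.append_of_depth h3 ?_, List.suffix_append _ _, ?_⟩
      · simpa [numR_append, numU_append, h1, h2] using h
      · intro x y hxy
        by_contra hy
        obtain ⟨t, ht, -⟩ := exists_overlap (List.prefix_refl p) hxy hy h4
        rw [h0] at ht
        exact ht
  rw [F, e, Set.ncard_image_of_injective _ (List.append_left_injective p), D]

/-- Append `p` to an avoiding path `v`. Any earlier occurrence of `p` overlaps the new one in a
bifix, hence ends exactly at `v ++ o`, a path counted by `F`; appending `p' ++ o` reverses this cut.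
-/
theorem F_add_F_eq_of_bifixes_eq_singleton {o p' : List Step} (ho : o ≠ [])
    (h1 : bifixes (o ++ p' ++ o) = {o}) {n m : ℕ}
    (h : n + numR (o ++ p' ++ o) + depth (o ++ p' ++ o) ≤ m + numU (o ++ p' ++ o)) :
    F (o ++ p' ++ o) (n + numR (o ++ p' ++ o)) (m + numU (o ++ p' ++ o)) +
      F (o ++ p' ++ o) (n + numR o) (m + numU o) = D (o ++ p' ++ o) n m := by
  obtain ⟨p, hp⟩ : ∃ p, p = o ++ p' ++ o := ⟨_, rfl⟩
  rw [← hp] at h h1 ⊢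
  have hp0 : p ≠ [] := by rw [hp]; simp [ho]
  have e : (fun v => v ++ p) '' paths p n m = endPaths p (n + numR p) (m + numU p) ∪
      (fun z => z ++ (p' ++ o)) '' endPaths p (n + numR o) (m + numU o) := by
    ext w
    constructor
    · rintro ⟨v, ⟨hv1, hv2, hv3, hv4⟩, rfl⟩
      have hb : IsBallot (v ++ p) := IsBallot.append_of_depth hv3
        (by simpa [numR_append, numU_append, hv1, hv2] using h)
      by_cases hxy : ∀ x y, v ++ p = x ++ p ++ y → y = []
      · left
        exact ⟨by simp [numR_append, hv1], by simp [numU_append, hv2], hb,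
          List.suffix_append _ _, hxy⟩
      · right
        push Not at hxy
        obtain ⟨x, y, hxy, hy⟩ := hxy
        obtain ⟨t, ht, ht1, ht2⟩ := exists_overlap (List.prefix_refl p) hxy hy hv4
        rw [h1] at ht
        obtain rfl : t = o := ht
        refine ⟨v ++ t, ⟨by simp [numR_append, hv1], by simp [numU_append, hv2],
          hb.of_prefix ?_, ⟨x, ht2⟩, ?_⟩, ?_⟩
        · exact (List.prefix_append_right_inj v).2 ⟨y, ht1.symm⟩
        · intro x2 y2 h2
          by_contra hy2
          obtain ⟨q, hq, hq1, -⟩ := exists_overlap ⟨y, ht1.symm⟩ h2 hy2 hv4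
          rw [h1] at hq
          obtain rfl : q = t := hq
          simp at hq1
          exact hy2 hq1
        · simp [hp]
    · rintro (⟨h1, h2, h3, ⟨v, rfl⟩, h5⟩ | ⟨z, ⟨h2, h3, h4, ⟨x, rfl⟩, h6⟩, rfl⟩)
      · rw [numR_append] at h1
        rw [numU_append] at h2
        exact ⟨v, ⟨by omega, by omega, h3.of_prefix (List.prefix_append _ _),
          endPaths_append_avoids h5 hp0 rfl⟩, rfl⟩
      · have hx : x ++ p = (x ++ o ++ p') ++ o := by simp [hp]
        refine ⟨x ++ o ++ p', ⟨?_, ?_, h4.of_prefix ⟨o, hx.symm⟩,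
          endPaths_append_avoids h6 ho hx⟩, ?_⟩
        · rw [hx, numR_append] at h2
          omega
        · rw [hx, numU_append] at h3
          omega
        · simp [hp]
  have d : Disjoint (endPaths p (n + numR p) (m + numU p))
      ((fun z => z ++ (p' ++ o)) '' endPaths p (n + numR o) (m + numU o)) := by
    rw [Set.disjoint_left]
    rintro w ⟨-, -, -, -, h5⟩ ⟨z, ⟨-, -, -, ⟨x, rfl⟩, -⟩, rfl⟩
    have := h5 x (p' ++ o) rfl
    exact ho (List.append_eq_nil_iff.1 this).2
  have := congrArg Set.ncard e
  rw [Set.ncard_union_eq d (endPaths_finite _ _ _) ((endPaths_finite _ _ _).image _),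
    Set.ncard_image_of_injective _ (List.append_left_injective _),
    Set.ncard_image_of_injective _ (List.append_left_injective _)] at this
  exact this.symm

theorem mem_bifixes {o p' : List Step} (ho : o ≠ []) : o ∈ bifixes (o ++ p' ++ o) := by
  refine ⟨ho, ?_, ⟨p' ++ o, by simp⟩, List.suffix_append _ _⟩
  intro h
  have := congrArg List.length h
  simp at this
  exact ho this.2

/-- A pattern without a shorter bifix than `o` splits as `o p' o`. -/
theorem exists_eq_append_of_bifixes_eq_singleton {o p : List Step} (h : bifixes p = {o}) :
    o ≠ [] ∧ ∃ p', p = o ++ p' ++ o := by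
  obtain ⟨ho, hop, ⟨t, ht⟩, ⟨t', ht'⟩⟩ : o ∈ bifixes p := h ▸ rfl
  refine ⟨ho, ?_⟩
  rcases List.append_eq_append_iff.1 (ht'.trans ht.symm) with ⟨s, h1, h2⟩ | ⟨s, h1, h2⟩
  · by_cases hs : s = []
    · subst hs
      refine ⟨[], ?_⟩
      rw [← ht]
      simp at h2
      simp [h2]
    · exfalso
      have hso : s <+: o := ⟨t, h2.symm⟩
      have hso' : s <:+ o := ⟨t', h1.symm⟩
      -- If the two copies of `o` overlapped, the overlap `s` would itself be a bifix, so `s = o`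
      -- and then `o = p`.
      have : s ∈ bifixes p := by
        refine ⟨hs, ?_, hso.trans ⟨t, ht⟩, hso'.trans ⟨t', ht'⟩⟩
        rintro rfl
        exact hop (List.IsPrefix.eq_of_length ⟨t, ht⟩
          (le_antisymm (List.IsPrefix.length_le ⟨t, ht⟩) hso.length_le))
      rw [h] at this
      obtain rfl : s = o := this
      simp at h2
      subst h2
      simp at ht
      exact hop ht
  · refine ⟨s, ?_⟩
    rw [← ht', h1]

/-- The recursion for the numbers `D` of paths avoiding a pattern and the numbers `F` of paths in
which the pattern occurs only at the end, with `ε = 0` and `ε = 1` for bifix index `0` and `1`. -/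
structure IsPatternCount (D F : ℕ → ℕ → ℝ) (a c b d δ : ℕ) (ε : ℝ) : Prop where
  one_le_δ : 1 ≤ δ
  two_le_a : 2 ≤ a
  c_le_a : c ≤ a
  one_le_b : 1 ≤ b
  b_le_a : b ≤ a
  d_le_b : d ≤ b
  d_le_c : d ≤ c
  D_zero : ∀ m, D 0 m = 1
  D_below : ∀ n, D (n + 1) n = 0
  recurrence : ∀ n m, n ≤ m → D (n + 1) (m + 1) + F (n + 1) (m + 1) = D n (m + 1) + D (n + 1) m
  F_depth : ∀ n m, m < n + δ → F n m = 0
  F_left : ∀ n m, n < a → F n m = 0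
  F_add : ∀ n m, n + a + δ ≤ m + c →
    F (n + a) (m + c) + ε * F (n + a - b) (m + c - d) = D n m

/-! ### Admissible patterns as instances of the recursion -/

theorem ne_nil_of_numR {p : List Step} (h : 2 ≤ numR p) : p ≠ [] := by
  rintro rfl
  simp [numR] at h

/-- As `ε = 0`, the values `b = 1` and `d = 0` are placeholders that meet the required inequalities.
-/
theorem Admissible.isPatternCount_zero {p : List Step} (hp : Admissible p)
    (h0 : bifixIndex p = 0) :
    IsPatternCount (fun n m => (D p n m : ℝ)) (fun n m => (F p n m : ℝ))
      (numR p) (numU p) 1 0 (depth p) 0 where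
  one_le_δ := hp.one_le_depth
  two_le_a := hp.two_le_numR
  c_le_a := hp.numU_le_numR
  one_le_b := le_rfl
  b_le_a := by have := hp.two_le_numR; omega
  d_le_b := Nat.zero_le _
  d_le_c := Nat.zero_le _
  D_zero m := by simp [D_zero_left (p := p) (by have := hp.two_le_numR; omega)]
  D_below n := by simp [D_eq_zero_of_lt]
  recurrence n m h := mod_cast D_succ_add_F_succ h
  F_depth n m h := by simp [F_eq_zero_of_lt_depth h]
  F_left n m h := by simp [F_eq_zero_of_lt_numR h]
  F_add n m h := by
    simp [F_add_eq_of_bifixes_eq_empty (ne_nil_of_numR hp.two_le_numR)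
      ((Set.ncard_eq_zero (bifixes_finite p)).1 h0) h]

theorem Admissible.isPatternCount_one {o p' : List Step} (ho : o ≠ [])
    (hp : Admissible (o ++ p' ++ o)) :
    IsPatternCount (fun n m => (D (o ++ p' ++ o) n m : ℝ)) (fun n m => (F (o ++ p' ++ o) n m : ℝ))
      (numR (o ++ p' ++ o)) (numU (o ++ p' ++ o)) (numR (o ++ p')) (numU (o ++ p'))
      (depth (o ++ p' ++ o)) 1 where
  one_le_δ := hp.one_le_depth
  two_le_a := hp.two_le_numR
  c_le_a := hp.numU_le_numR
  one_le_b := by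
    have h1 := hp.bifix_dim o p' ho rfl
    have h2 := numR_add_numU (o ++ p')
    have h3 : 0 < (o ++ p').length := by
      rw [List.length_append]
      have := List.length_pos_of_ne_nil ho
      omega
    omega
  b_le_a := by rw [numR_append (o ++ p')]; omega
  d_le_b := hp.bifix_dim o p' ho rfl
  d_le_c := by rw [numU_append (o ++ p')]; omega
  D_zero m := mod_cast D_zero_left (by have := hp.two_le_numR; omega) m
  D_below n := by simp [D_eq_zero_of_lt]
  recurrence n m h := mod_cast D_succ_add_F_succ h
  F_depth n m h := mod_cast F_eq_zero_of_lt_depth h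
  F_left n m h := mod_cast F_eq_zero_of_lt_numR h
  F_add n m h := by
    have h1 : bifixes (o ++ p' ++ o) = {o} := by
      have hm := mem_bifixes (p' := p') ho
      rcases hp.bifixIndex_le with h0 | h1
      · rw [bifixIndex, Set.ncard_eq_zero (bifixes_finite _)] at h0
        exact absurd (h0 ▸ hm) (Set.notMem_empty o)
      · obtain ⟨q, hq⟩ := Set.ncard_eq_one.1 h1
        rw [hq] at hm ⊢
        rw [show o = q from hm]
    have := F_add_F_eq_of_bifixes_eq_singleton ho h1 h
    have e1 : n + numR (o ++ p' ++ o) - numR (o ++ p') = n + numR o := by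
      rw [numR_append (o ++ p')]; omega
    have e2 : m + numU (o ++ p' ++ o) - numU (o ++ p') = m + numU o := by
      rw [numU_append (o ++ p')]; omega
    rw [e1, e2, one_mul]
    exact_mod_cast this

theorem Admissible.exists_isPatternCount {p : List Step} (hp : Admissible p) :
    ∃ b d ε, IsPatternCount (fun n m => (D p n m : ℝ)) (fun n m => (F p n m : ℝ))
      (numR p) (numU p) b d (depth p) ε := by
  rcases hp.bifixIndex_le with h0 | h1
  · exact ⟨_, _, _, hp.isPatternCount_zero h0⟩
  · obtain ⟨o, ho⟩ := Set.ncard_eq_one.1 h1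
    obtain ⟨h, p', rfl⟩ := exists_eq_append_of_bifixes_eq_singleton ho
    exact ⟨_, _, _, hp.isPatternCount_one h⟩

/-! ### Shifts -/

theorem eval_E (v x : ℝ) (f : ℝ[X]) : (E v f).eval x = f.eval (x + v) := by
  simp [E, eval_comp]

theorem E_C (v c : ℝ) : E v (C c) = C c := by simp [E]

theorem E_mul_E (v w : ℝ) : E v * E w = E (v + w) := by
  refine LinearMap.ext fun f => Polynomial.funext fun x => ?_
  rw [Module.End.mul_apply, eval_E, eval_E, eval_E, add_assoc]

theorem E_E (v w : ℝ) (f : ℝ[X]) : E v (E w f) = E (v + w) f := by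
  rw [← E_mul_E, Module.End.mul_apply]

theorem E_zero : E 0 = 1 := by
  refine LinearMap.ext fun f => Polynomial.funext fun x => ?_
  rw [eval_E, add_zero, Module.End.one_apply]

theorem E_pow (v : ℝ) (k : ℕ) : E v ^ k = E (k * v) := by
  induction k with
  | zero => simp [E_zero]
  | succ k ih => rw [pow_succ, ih, E_mul_E]; congr 1; push_cast; ring

theorem E_mul (v : ℝ) (f g : ℝ[X]) : E v (f * g) = E v f * E v g := by simp [E]

theorem degree_E (v : ℝ) (f : ℝ[X]) : (E v f).degree = f.degree := degree_taylor f v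

section

/-! ### Sheffer sequences -/

/-- Two operators that agree on polynomials of every degree are equal. -/
theorem op_ext {s : ℕ → ℝ[X]} (hs : ∀ n : ℕ, (s n).degree = n) {S T : Op}
    (h : ∀ n, S (s n) = T (s n)) : S = T := by
  let q : Polynomial.Sequence ℝ := ⟨s, hs⟩
  exact (q.basis fun i => (leadingCoeff_ne_zero.2 (q.ne_zero i)).isUnit).ext
    fun n => by simpa [q] using h n

theorem degreeLT_induction {s : ℕ → ℝ[X]} (hs : ∀ n : ℕ, (s n).degree = n) {n : ℕ}
    {M : Submodule ℝ ℝ[X]} (h : ∀ k < n, s k ∈ M) : degreeLT ℝ n ≤ M := by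
  let q : Polynomial.Sequence ℝ := ⟨s, hs⟩
  rw [← q.span_degreeLT fun i _ => (leadingCoeff_ne_zero.2 (q.ne_zero i)).isUnit,
    Submodule.span_le]
  rintro _ ⟨k, hk, rfl⟩
  exact h k hk

variable {B : Op} {s b : ℕ → ℝ[X]}

theorem IsSheffer.exists_eq_C (hs : IsSheffer B s) : ∃ c : ℝ, c ≠ 0 ∧ s 0 = C c := by
  have h := hs.1 0
  refine ⟨(s 0).coeff 0, ?_, eq_C_of_degree_le_zero h.le⟩
  intro h0
  rw [eq_C_of_degree_le_zero h.le, h0] at h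
  simp at h

theorem IsSheffer.map_C (hs : IsSheffer B s) (c : ℝ) : B (C c) = 0 := by
  obtain ⟨k, hk, h⟩ := hs.exists_eq_C
  have : C c = (c / k) • s 0 := by rw [h, smul_C, smul_eq_mul, div_mul_cancel₀ _ hk]
  rw [this, map_smul, hs.2.1, smul_zero]

/-- In the basis `s`, `B` shifts coordinates down by one, so only the coordinate at `s 0` survives
in the kernel. -/
theorem IsSheffer.eq_C_of_map_eq_zero (hs : IsSheffer B s) {f : ℝ[X]} (hf : B f = 0) :
    ∃ c : ℝ, f = C c := by
  let q : Polynomial.Sequence ℝ := ⟨s, hs.1⟩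
  let β := q.basis fun i => (leadingCoeff_ne_zero.2 (q.ne_zero i)).isUnit
  have hβ : ∀ n, β n = s n := fun n => by simp [β, q]
  have key : ∀ k, (β.coord k) ∘ₗ B = β.coord (k + 1) := by
    refine fun k => β.ext fun n => ?_
    rw [LinearMap.comp_apply]
    cases n with
    | zero => rw [hβ, hs.2.1]; simp [← hβ]
    | succ n => rw [hβ, hs.2.2]; simp [← hβ, Finsupp.single_apply]
  obtain ⟨c, -, hc⟩ := hs.exists_eq_C
  refine ⟨β.repr f 0 * c, ?_⟩
  have h : β.repr f = Finsupp.single 0 (β.repr f 0) := by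
    ext n
    cases n with
    | zero => simp
    | succ n =>
      have := LinearMap.congr_fun (key n) f
      rw [LinearMap.comp_apply, hf] at this
      simp at this
      simp [← this]
  have := β.linearCombination_repr f
  rw [h, Finsupp.linearCombination_single, hβ, hc, smul_C, smul_eq_mul] at this
  exact this.symm

/-- A sequence with `B g_n = g_{n-1}` is determined by its values at one point. -/
theorem IsSheffer.eq_of_eval_eq (hs : IsSheffer B s) {g h : ℕ → ℝ[X]} (hg0 : B (g 0) = 0)
    (hg : ∀ n, B (g (n + 1)) = g n) (hh0 : B (h 0) = 0) (hh : ∀ n, B (h (n + 1)) = h n)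
    (x : ℝ) (hx : ∀ n, (g n).eval x = (h n).eval x) (n : ℕ) : g n = h n := by
  have key : B (g n - h n) = 0 := by
    cases n with
    | zero => rw [map_sub, hg0, hh0, sub_zero]
    | succ n => rw [map_sub, hg, hh, IsSheffer.eq_of_eval_eq hs hg0 hg hh0 hh x hx n, sub_self]
  obtain ⟨c, hc⟩ := hs.eq_C_of_map_eq_zero key
  have := congrArg (eval x) hc
  rw [eval_sub, hx, sub_self, eval_C] at this
  rw [← this, C_0] at hc
  exact sub_eq_zero.1 hc

theorem IsSheffer.pow_apply (hs : IsSheffer B s) (k n : ℕ) :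
    (B ^ k) (s n) = if k ≤ n then s (n - k) else 0 := by
  induction k with
  | zero => simp
  | succ k ih =>
    rw [pow_succ', Module.End.mul_apply, ih]
    rcases lt_trichotomy k n with h | rfl | h
    · rw [if_pos h.le, if_pos (by omega), show n - k = n - (k + 1) + 1 by omega, hs.2.2]
    · simp [hs.2.1]
    · rw [if_neg (by omega), if_neg (by omega), map_zero]

theorem IsSheffer.shift (hs : IsSheffer B s) (hB : ∀ v : ℝ, B * E v = E v * B) (v : ℝ) :
    IsSheffer B (fun n => E v (s n)) := by
  have h : ∀ f, B (E v f) = E v (B f) := fun f => LinearMap.congr_fun (hB v) f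
  refine ⟨fun n => by rw [degree_E, hs.1], ?_, fun n => ?_⟩
  · rw [h, hs.2.1, map_zero]
  · rw [h, hs.2.2]

/-- The Sheffer sequence `s_n(n + x)` of the operator `E^{-1} B`. -/
theorem IsSheffer.B₁ (hs : IsSheffer B s) (hB : ∀ v : ℝ, B * E v = E v * B) :
    IsSheffer (B₁ B) (fun n => E n (s n)) := by
  have h : ∀ v f, B (E v f) = E v (B f) := fun v f => LinearMap.congr_fun (hB v) f
  refine ⟨fun n => by rw [degree_E, hs.1], ?_, fun n => ?_⟩
  · rw [BallotPath.B₁, Module.End.mul_apply, h, hs.2.1, map_zero, map_zero]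
  · rw [BallotPath.B₁, Module.End.mul_apply, h, hs.2.2, E_E]
    congr 2
    push_cast
    ring

/-! ### Basic sequences and their Abelization -/

theorem sum_antidiagonal_smul_comm (u v : ℕ → ℝ) (g : ℕ → ℝ[X]) (n : ℕ) :
    ∑ p ∈ Finset.HasAntidiagonal.antidiagonal n, u p.1 • ∑ q ∈ Finset.HasAntidiagonal.antidiagonal p.2, v q.1 • g q.2 =
      ∑ p ∈ Finset.HasAntidiagonal.antidiagonal n, v p.1 • ∑ q ∈ Finset.HasAntidiagonal.antidiagonal p.2, u q.1 • g q.2 := by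
  have h := congrArg (PowerSeries.coeff n)
    (mul_left_comm (PowerSeries.mk fun i => C (u i)) (PowerSeries.mk fun i => C (v i))
      (PowerSeries.mk g))
  simpa only [PowerSeries.coeff_mul, PowerSeries.coeff_mk, ← smul_eq_C_mul] using h

theorem IsBasic.zero (hb : IsBasic B b) : b 0 = 1 := by
  obtain ⟨c, -, hc⟩ := hb.1.exists_eq_C
  have := hb.2 0
  rw [hc, eval_C, if_pos rfl] at this
  rw [hc, this, C_1]

/-- The binomial theorem for basic sequences: both sides are lowered by `B` and agree at `0`. -/
theorem IsBasic.E_eq_sum (hb : IsBasic B b) (hB : ∀ v : ℝ, B * E v = E v * B) (y : ℝ) (n : ℕ) :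
    E y (b n) = ∑ p ∈ Finset.HasAntidiagonal.antidiagonal n, (b p.1).eval y • b p.2 := by
  have hs := hb.1.shift hB y
  refine hb.1.eq_of_eval_eq (g := fun n => E y (b n)) hs.2.1 hs.2.2
    (h := fun n => ∑ p ∈ Finset.HasAntidiagonal.antidiagonal n, (b p.1).eval y • b p.2) ?_ ?_ 0 ?_ n
  · simp [hb.1.2.1]
  · intro n
    rw [Finset.Nat.sum_antidiagonal_succ', map_add, map_sum, map_smul, hb.1.2.1, smul_zero,
      zero_add]
    exact Finset.sum_congr rfl fun p _ => by rw [map_smul, hb.1.2.2]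
  · intro n
    rw [eval_E, zero_add, eval_finsetSum, Finset.sum_eq_single (n, 0)]
    · simp [hb.zero]
    · rintro ⟨i, j⟩ hij hne
      have : j ≠ 0 := by
        rintro rfl
        simp at hij
        exact hne (by rw [hij])
      simp [hb.2, this]
    · simp

/-- Differentiate the binomial theorem in one of its two variables, at `0`. -/
theorem IsBasic.derivative_eq_sum (hb : IsBasic B b) (hB : ∀ v : ℝ, B * E v = E v * B) (n : ℕ) :
    derivative (b n) = ∑ p ∈ Finset.HasAntidiagonal.antidiagonal n, (derivative (b p.1)).eval 0 • b p.2 := by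
  refine Polynomial.funext fun x => ?_
  have h : E x (b n) = ∑ p ∈ Finset.HasAntidiagonal.antidiagonal n, (b p.2).eval x • b p.1 := by
    refine Polynomial.funext fun y => ?_
    rw [eval_E, add_comm, ← eval_E, hb.E_eq_sum hB, eval_finsetSum, eval_finsetSum]
    exact Finset.sum_congr rfl fun p _ => by simp [mul_comm]
  have := congrArg (fun f => (derivative f).eval 0) h
  simpa [E, derivative_comp, eval_comp, eval_finsetSum, derivative_sum, mul_comm] using this

/-- The quotients `n b_n(x) / x` for a basic sequence `b`. -/
noncomputable def quot (b : ℕ → ℝ[X]) (n : ℕ) : ℝ[X] :=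
  ∑ p ∈ Finset.HasAntidiagonal.antidiagonal n, ((p.1 : ℝ) * (derivative (b p.1)).eval 0) • b p.2

theorem IsBasic.derivative_quot (hb : IsBasic B b) (hB : ∀ v : ℝ, B * E v = E v * B) (n : ℕ) :
    derivative (quot b n) =
      ∑ p ∈ Finset.HasAntidiagonal.antidiagonal n, (derivative (b p.1)).eval 0 • quot b p.2 := by
  have h := sum_antidiagonal_smul_comm (fun i => (i : ℝ) * (derivative (b i)).eval 0)
    (fun i => (derivative (b i)).eval 0) b n
  unfold quot
  rw [← h, derivative_sum]
  exact Finset.sum_congr rfl fun p _ => by rw [derivative_smul, hb.derivative_eq_sum hB p.2]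

/-- Formally `∑ b_n t^n = exp(x β(t))` with `β_i = b_i'(0)`, and this is its logarithmic derivative
in `t`. The proof instead compares derivatives in `x` and values at `0`. -/
theorem IsBasic.X_mul_quot (hb : IsBasic B b) (hB : ∀ v : ℝ, B * E v = E v * B) (n : ℕ) :
    X * quot b n = (n : ℝ) • b n := by
  induction n using Nat.strong_induction_on with
  | _ n ih =>
    have h : derivative (X * quot b n - (n : ℝ) • b n) = 0 := by
      rw [derivative_sub, derivative_mul, derivative_X, one_mul, hb.derivative_quot hB,
        derivative_smul, hb.derivative_eq_sum hB n, quot, Finset.mul_sum, Finset.smul_sum,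
        ← Finset.sum_add_distrib, ← Finset.sum_sub_distrib]
      refine Finset.sum_eq_zero ?_
      rintro ⟨i, j⟩ hij
      have hij : i + j = n := by simpa using hij
      rcases Nat.eq_zero_or_pos i with rfl | hi
      · simp [hb.zero]
      · rw [mul_smul_comm, ih j (by omega), ← hij]
        push_cast
        module
    have h0 := eq_C_of_derivative_eq_zero h
    have h1 : (X * quot b n - (n : ℝ) • b n).coeff 0 = 0 := by
      rw [coeff_zero_eq_eval_zero]
      rcases Nat.eq_zero_or_pos n with rfl | hn
      · simp
      · simp [hb.2, hn.ne']
    rw [h1, C_0] at h0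
    exact sub_eq_zero.1 h0

theorem IsBasic.B_quot_succ (hb : IsBasic B b) (n : ℕ) : B (quot b (n + 1)) = quot b n := by
  unfold quot
  rw [Finset.Nat.sum_antidiagonal_succ', map_add, map_sum, map_smul, hb.1.2.1, smul_zero,
    zero_add]
  exact Finset.sum_congr rfl fun p _ => by rw [map_smul, hb.1.2.2]

theorem quot_zero (b : ℕ → ℝ[X]) : quot b 0 = 0 := by
  simp [quot]

/-- Removes the division: `x (b_n - quot_n) = (x - n) b_n`, shifted by `n + v`. The action of `B₁`
can then be read off. -/
theorem IsBasic.abel_eq (hb : IsBasic B b) (hB : ∀ v : ℝ, B * E v = E v * B) (n : ℕ) (v : ℝ) :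
    abel b n v = E (n + v) (b n - quot b n) := by
  have hne : (X + C ((n : ℝ) + v) : ℝ[X]) ≠ 0 := (monic_X_add_C _).ne_zero
  refine mul_left_cancel₀ hne ?_
  have h : X * (b n - quot b n) = (X - C (n : ℝ)) * b n := by
    rw [mul_sub, hb.X_mul_quot hB, smul_eq_C_mul]; ring
  have := congrArg (E (n + v)) h
  rw [E_mul, E_mul] at this
  rw [mul_abel hb]
  have e1 : E (n + v) X = X + C ((n : ℝ) + v) := by simp [E]
  have e2 : E (n + v) (X - C (n : ℝ)) = X + C v := by simp [E]; ring
  rw [e1, e2] at this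
  exact this.symm

theorem IsBasic.abel_zero (hb : IsBasic B b) (hB : ∀ v : ℝ, B * E v = E v * B) (v : ℝ) :
    abel b 0 v = 1 := by
  rw [hb.abel_eq hB, quot_zero, sub_zero, hb.zero, ← C_1, E_C]

theorem IsBasic.E_abel (hb : IsBasic B b) (hB : ∀ v : ℝ, B * E v = E v * B) (n : ℕ) (v w : ℝ) :
    E w (abel b n v) = abel b n (v + w) := by
  rw [hb.abel_eq hB, hb.abel_eq hB, E_E]
  congr 2
  ring

theorem IsBasic.eval_abel (hb : IsBasic B b) (hB : ∀ v : ℝ, B * E v = E v * B) (n : ℕ) (v : ℝ) :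
    (abel b n v).eval (-v) = if n = 0 then 1 else 0 := by
  rcases Nat.eq_zero_or_pos n with rfl | hn
  · simp [hb.abel_zero hB]
  · have h := congrArg (eval (-v)) (mul_abel hb n v)
    rw [if_neg hn.ne']
    simpa [hn.ne'] using h

theorem IsBasic.B₁_abel_zero (hb : IsBasic B b) (hB : ∀ v : ℝ, B * E v = E v * B) (v : ℝ) :
    B₁ B (abel b 0 v) = 0 := by
  rw [hb.abel_zero hB, B₁, Module.End.mul_apply, ← C_1, hb.1.map_C, map_zero]

theorem IsBasic.B₁_abel_succ (hb : IsBasic B b) (hB : ∀ v : ℝ, B * E v = E v * B) (n : ℕ) (v : ℝ) :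
    B₁ B (abel b (n + 1) v) = abel b n v := by
  have h : ∀ v f, B (E v f) = E v (B f) := fun v f => LinearMap.congr_fun (hB v) f
  rw [hb.abel_eq hB, hb.abel_eq hB, B₁, Module.End.mul_apply, h, map_sub, hb.1.2.2,
    hb.B_quot_succ, E_E]
  congr 2
  push_cast
  ring

theorem IsBasic.B₁_pow_abel (hb : IsBasic B b) (hB : ∀ v : ℝ, B * E v = E v * B) (n k : ℕ)
    (v : ℝ) : (B₁ B ^ k) (abel b n v) = if k ≤ n then abel b (n - k) v else 0 := by
  induction k with
  | zero => simp
  | succ k ih =>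
    rw [pow_succ', Module.End.mul_apply, ih]
    rcases lt_trichotomy k n with h | rfl | h
    · rw [if_pos h.le, if_pos (by omega), show n - k = n - (k + 1) + 1 by omega,
        hb.B₁_abel_succ hB]
    · simp [hb.B₁_abel_zero hB]
    · rw [if_neg (by omega), if_neg (by omega), map_zero]

end

/-! ### The operator form of the recursion -/

theorem eq_of_eval_natCast_eq {f g : ℝ[X]} (N : ℕ)
    (h : ∀ m : ℕ, N ≤ m → f.eval (m : ℝ) = g.eval (m : ℝ)) : f = g := by
  refine eq_of_infinite_eval_eq f g (((Set.Ici_infinite N).image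
    (Nat.cast_injective (R := ℝ)).injOn).mono ?_)
  rintro _ ⟨m, hm, rfl⟩
  exact h m hm

theorem commute_E_E (v w : ℝ) : Commute (E v) (E w) := by
  rw [commute_iff_eq, E_mul_E, E_mul_E, add_comm]

/-- The operator `B + E^{-1} - 1`. -/
noncomputable def defect (B : Op) : Op := B + E (-1) - 1

theorem eval_defect (B : Op) (f : ℝ[X]) (x : ℝ) :
    (defect B f).eval x = (B f).eval x + f.eval (x - 1) - f.eval x := by
  simp [defect, eval_E, sub_eq_add_neg]

variable {B : Op} {s q : ℕ → ℝ[X]} {D F : ℕ → ℕ → ℝ} {a c b d δ : ℕ} {ε : ℝ}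

section

variable (h : IsPatternCount D F a c b d δ ε) (hs : IsSheffer B s)
  (hD : ∀ n m : ℕ, n + δ ≤ m → D n m = (s n).eval (m : ℝ))

include h hs hD

theorem IsPatternCount.sheffer_zero : s 0 = 1 := by
  obtain ⟨k, -, hk⟩ := hs.exists_eq_C
  have := hD 0 δ (by omega)
  rw [h.D_zero, hk, eval_C] at this
  rw [hk, ← this, C_1]

/-- The inequality is strict because `(n, m - 1)` must also lie where `s` is known to count. -/
theorem IsPatternCount.eval_defect_of_lt {n m : ℕ} (hnm : n + δ < m) :
    (defect B (s n)).eval (m : ℝ) = F n m := by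
  obtain ⟨l, rfl⟩ : ∃ l, m = l + 1 := ⟨m - 1, by omega⟩
  have e : ((l + 1 : ℕ) : ℝ) - 1 = l := by push_cast; ring
  rw [eval_defect, e, ← hD n l (by omega), ← hD n (l + 1) (by omega)]
  cases n with
  | zero =>
    rw [hs.2.1, h.D_zero, h.D_zero, h.F_left _ _ (by have := h.two_le_a; omega)]
    simp
  | succ n =>
    rw [hs.2.2, ← hD n (l + 1) (by omega)]
    have := h.recurrence n l (by omega)
    linarith

theorem IsPatternCount.defect_eq_zero {n : ℕ} (hn : n < a) : defect B (s n) = 0 := by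
  refine eq_of_eval_natCast_eq (n + δ + 1) fun m hm => ?_
  rw [h.eval_defect_of_lt hs hD hm, h.F_left n m hn, eval_zero]

theorem IsPatternCount.defect_add (n : ℕ) :
    defect B (s (n + a)) + ε • E (-d) (defect B (s (n + a - b))) = E (-c) (s n) := by
  refine eq_of_eval_natCast_eq (n + a + δ + 1 + c) fun m hm => ?_
  obtain ⟨l, rfl⟩ : ∃ l, m = l + c := ⟨m - c, by omega⟩
  have h1 := h.b_le_a
  have h2 := h.d_le_b
  have h3 := h.d_le_c
  have e1 : ((l + c : ℕ) : ℝ) + -(d : ℝ) = ((l + c - d : ℕ) : ℝ) := by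
    rw [Nat.cast_sub (by omega)]; ring
  have e2 : ((l + c : ℕ) : ℝ) + -(c : ℝ) = (l : ℝ) := by push_cast; ring
  rw [eval_add, eval_smul, eval_E, eval_E, e1, e2, smul_eq_mul,
    h.eval_defect_of_lt hs hD (by omega), h.eval_defect_of_lt hs hD (by omega),
    ← hD n l (by omega), h.F_add n l (by omega)]

theorem IsPatternCount.defect_op_add :
    defect B + ε • (E (-d) * (defect B * B ^ b)) = E (-c) * B ^ a := by
  refine op_ext hs.1 fun n => ?_
  simp only [LinearMap.add_apply, LinearMap.smul_apply, Module.End.mul_apply, hs.pow_apply]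
  rcases lt_or_ge n a with hn | hn
  · rw [if_neg (show ¬ a ≤ n by omega), h.defect_eq_zero hs hD hn]
    split_ifs with hb
    · rw [h.defect_eq_zero hs hD (by omega)]
      simp
    · simp
  · obtain ⟨k, rfl⟩ : ∃ k, n = k + a := ⟨n - a, by omega⟩
    have := h.b_le_a
    rw [if_pos (by omega), if_pos hn, h.defect_add hs hD, Nat.add_sub_cancel]

/-- Gains the boundary `m = n + δ`: induction through `F_add` replaces the step recursion, so the
point below is not needed. -/
theorem IsPatternCount.eval_defect (n m : ℕ) (hnm : n + δ ≤ m) :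
    (defect B (s n)).eval (m : ℝ) = F n m := by
  induction n using Nat.strong_induction_on generalizing m with
  | _ n ih =>
    rcases lt_or_ge n a with hn | hn
    · rw [h.defect_eq_zero hs hD hn, h.F_left n m hn, eval_zero]
    · obtain ⟨k, rfl⟩ : ∃ k, n = k + a := ⟨n - a, by omega⟩
      have h0 := h.one_le_b
      have h1 := h.b_le_a
      have h2 := h.d_le_b
      have h3 := h.d_le_c
      have h4 := h.c_le_a
      obtain ⟨l, rfl⟩ : ∃ l, m = l + c := ⟨m - c, by omega⟩
      have e1 : ((l + c : ℕ) : ℝ) + -(d : ℝ) = ((l + c - d : ℕ) : ℝ) := by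
        rw [Nat.cast_sub (by omega)]; ring
      have e2 : ((l + c : ℕ) : ℝ) + -(c : ℝ) = (l : ℝ) := by push_cast; ring
      have h5 := congrArg (eval ((l + c : ℕ) : ℝ)) (h.defect_add hs hD k)
      rw [eval_add, eval_smul, eval_E, eval_E, e1, e2, smul_eq_mul,
        ih (k + a - b) (by omega) (l + c - d) (by omega), ← hD k l (by omega),
        ← h.F_add k l (by omega)] at h5
      linarith

theorem IsPatternCount.op_eq (hB : ∀ v : ℝ, B * E v = E v * B) :
    (1 - B - E (-1)) * (1 + ε • (B ^ b * E (-d))) = -(B ^ a * E (-c)) := by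
  have hB' : ∀ v, Commute B (E v) := hB
  have e : (1 - B - E (-1) : Op) = -defect B := by rw [defect]; abel
  have h1 : Commute (defect B) (E (-d)) :=
    ((hB' _).add_left (commute_E_E _ _)).sub_left (Commute.one_left _)
  have h2 := h.defect_op_add hs hD
  rw [((hB' (-c)).pow_left a).eq, ← h2, e, ((hB' (-d)).pow_left b).eq]
  refine (neg_mul (α := Op) _ _).trans (congrArg _ ?_)
  rw [mul_add, mul_one, mul_smul_comm, ← mul_assoc, h1.eq, mul_assoc]

/-! ### Agreement of the polynomials with the path counts -/

theorem IsPatternCount.eq_eval {x : ℕ} (hx : δ ≤ x + 1) (n : ℕ) :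
    D n (n + x) = (s n).eval ((n + x : ℕ) : ℝ) := by
  rcases eq_or_lt_of_le hx with hx | hx
  · cases n with
    | zero => rw [h.D_zero, h.sheffer_zero hs hD, eval_one]
    | succ n =>
      -- On the line of height `δ` the step recursion and the defect of `s` have the same source
      -- term `F`; subtracting them transfers agreement to height `δ - 1`.
      have h1 := h.recurrence n (n + δ) (by omega)
      have h2 := h.eval_defect hs hD (n + 1) (n + δ + 1) (by omega)
      have e : ((n + δ + 1 : ℕ) : ℝ) - 1 = (n + δ : ℕ) := by push_cast; ring
      rw [BallotPath.eval_defect, hs.2.2, e, ← hD n _ (by omega),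
        ← hD (n + 1) (n + δ + 1) (by omega)] at h2
      rw [show n + 1 + x = n + δ by omega]
      linarith
  · exact hD n (n + x) (by omega)

/-- In these columns `F` and the defect both vanish, so the discrepancy is constant in `m` and zero
high up. -/
theorem IsPatternCount.eq_eval_of_lt {n : ℕ} (hn : n < a) {m : ℕ} (hm : n ≤ m) :
    D n m = (s n).eval (m : ℝ) := by
  induction n generalizing m with
  | zero => rw [h.D_zero, h.sheffer_zero hs hD, eval_one]
  | succ n ih =>
    have key : ∀ j : ℕ, D (n + 1) (m + j) - (s (n + 1)).eval ((m + j : ℕ) : ℝ) =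
        D (n + 1) m - (s (n + 1)).eval (m : ℝ) := by
      intro j
      induction j with
      | zero => rfl
      | succ j ihj =>
        have h1 := h.recurrence n (m + j) (by omega)
        have h2 := congrArg (eval ((m + j + 1 : ℕ) : ℝ)) (h.defect_eq_zero hs hD hn)
        have e : ((m + j + 1 : ℕ) : ℝ) - 1 = (m + j : ℕ) := by push_cast; ring
        rw [BallotPath.eval_defect, hs.2.2, e, ← ih (by omega) (by omega), eval_zero] at h2
        rw [h.F_left _ _ hn] at h1
        rw [← ihj, ← add_assoc]
        linarith
    have h1 := key δ
    rw [hD (n + 1) (m + δ) (by omega)] at h1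
    linarith

/-- In column `a` the defect is `1` while `F` is still `0` below height `δ`. The discrepancy thus
grows by `1` per step up and reaches `0` at height `δ - 1`, so it is nonzero before. -/
theorem IsPatternCount.ne_eval {x : ℕ} (hx : x + 1 < δ) :
    D a (a + x) ≠ (s a).eval ((a + x : ℕ) : ℝ) := by
  have ha := h.two_le_a
  obtain ⟨k, hk⟩ : ∃ k, a = k + 1 := ⟨a - 1, by omega⟩
  have h0 : defect B (s a) = 1 := by
    have h1 := h.defect_add hs hD 0
    have := h.one_le_b
    rw [zero_add, h.defect_eq_zero hs hD (n := a - b) (by omega), h.sheffer_zero hs hD, map_zero,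
      smul_zero, add_zero, ← C_1, E_C] at h1
    rw [h1, C_1]
  have key : ∀ j : ℕ, x + j < δ → D a (a + x + j) - (s a).eval ((a + x + j : ℕ) : ℝ) =
      D a (a + x) - (s a).eval ((a + x : ℕ) : ℝ) + j := by
    intro j
    induction j with
    | zero => intro _; simp
    | succ j ihj =>
      intro hj
      have h1 := h.recurrence k (a + x + j) (by omega)
      have h2 := congrArg (eval ((a + x + j + 1 : ℕ) : ℝ)) h0
      have e : ((a + x + j + 1 : ℕ) : ℝ) - 1 = (a + x + j : ℕ) := by push_cast; ring
      have h3 : B (s a) = s k := by rw [hk, hs.2.2]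
      rw [BallotPath.eval_defect, h3, e, ← h.eq_eval_of_lt hs hD (by omega) (by omega),
        eval_one] at h2
      rw [← hk, h.F_depth _ _ (by omega)] at h1
      have h4 := ihj (by omega)
      rw [← add_assoc]
      push_cast at h1 h2 h4 ⊢
      linarith
  intro h1
  obtain ⟨j, hj⟩ : ∃ j, x + j + 1 = δ := ⟨δ - x - 1, by omega⟩
  have h2 := key j (by omega)
  have h3 := h.eq_eval hs hD (x := x + j) (by omega) a
  rw [← add_assoc] at h3
  rw [h1, h3, sub_self, sub_self, zero_add] at h2
  have : (0 : ℕ) = j := by exact_mod_cast h2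
  omega

theorem IsPatternCount.forall_eq_eval_iff (x : ℕ) :
    (∀ n : ℕ, D n (n + x) = (s n).eval ((n : ℝ) + x)) ↔ δ ≤ x + 1 := by
  constructor
  · intro h1
    by_contra hx
    refine h.ne_eval hs hD (x := x) (by omega) ?_
    rw [h1 a]
    push_cast
    rfl
  · intro hx n
    rw [h.eq_eval hs hD hx n]
    push_cast
    rfl

end

/-! ### The expansion in terms of the basic sequence -/

/-- The polynomials `∑ i, C(k - i, i) (-z)^i`, as power series. -/
noncomputable def fibPoly (k : ℕ) : PowerSeries ℝ :=
  ∑ p ∈ Finset.HasAntidiagonal.antidiagonal k,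
    (p.1.choose p.2 : PowerSeries ℝ) * (-PowerSeries.X) ^ p.2

/-- Pascal's rule, termwise. -/
theorem fibPoly_add_two (k : ℕ) :
    fibPoly (k + 2) = fibPoly (k + 1) - PowerSeries.X * fibPoly k := by
  have h1 : fibPoly (k + 2) = 1 + ∑ p ∈ Finset.HasAntidiagonal.antidiagonal k,
      ((p.1 + 1).choose (p.2 + 1) : PowerSeries ℝ) * (-PowerSeries.X) ^ (p.2 + 1) := by
    rw [fibPoly, Finset.Nat.sum_antidiagonal_succ, Finset.Nat.sum_antidiagonal_succ']
    simp
  have h2 : fibPoly (k + 1) = 1 + ∑ p ∈ Finset.HasAntidiagonal.antidiagonal k,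
      (p.1.choose (p.2 + 1) : PowerSeries ℝ) * (-PowerSeries.X) ^ (p.2 + 1) := by
    rw [fibPoly, Finset.Nat.sum_antidiagonal_succ']
    simp
  rw [h1, h2, fibPoly, Finset.mul_sum, add_sub_assoc, ← Finset.sum_sub_distrib]
  congr 1
  refine Finset.sum_congr rfl fun p _ => ?_
  rw [Nat.choose_succ_succ]
  push_cast
  ring

theorem fibPoly_eq_sum_range (k : ℕ) :
    fibPoly k = ∑ i ∈ Finset.range (k + 1),
      ((k - i).choose i : PowerSeries ℝ) * (-PowerSeries.X) ^ i := by
  rw [fibPoly, ← Finset.Nat.sum_antidiagonal_swap,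
    Finset.Nat.sum_antidiagonal_eq_sum_range_succ_mk]
  rfl

/-- The backward solution of `d_j = d_{j+1} - z d_{j+2}`. -/
theorem eq_fibPoly_mul {g : ℕ → PowerSeries ℝ} {δ : ℕ}
    (hg : ∀ j < δ, g j = g (j + 1) - PowerSeries.X * g (j + 2)) (k j : ℕ) (hk : j + k + 1 = δ) :
    g j = fibPoly (k + 1) * g δ - PowerSeries.X * fibPoly k * g (δ + 1) := by
  have h0 : fibPoly 0 = 1 := by simp [fibPoly]
  have h1 : fibPoly 1 = 1 := by simp [fibPoly, Finset.Nat.sum_antidiagonal_succ]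
  induction k using Nat.strong_induction_on generalizing j with
  | _ k ih =>
    rw [hg j (by omega)]
    match k with
    | 0 =>
      subst hk
      simp [h0, h1]
    | 1 =>
      rw [ih 0 (by omega) (j + 1) (by omega), fibPoly_add_two, h0, h1, ← hk]
      ring
    | k + 2 =>
      rw [ih (k + 1) (by omega) (j + 1) (by omega), ih k (by omega) (j + 2) (by omega),
        fibPoly_add_two (k + 1)]
      have := fibPoly_add_two k
      linear_combination (PowerSeries.X * g (δ + 1)) * this

theorem sum_Icc_half_eq {M : Type*} [AddCommMonoid M] {δ : ℕ} (hδ : 1 ≤ δ) (f : ℕ → M)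
    (hf : ∀ i, δ + 1 < 2 * i → f i = 0) :
    ∑ i ∈ Finset.Icc 1 ((δ + 1) / 2), f i = ∑ i ∈ Finset.range δ, f (i + 1) := by
  have h1 : ∑ i ∈ Finset.Icc 1 ((δ + 1) / 2), f i = ∑ i ∈ Finset.Icc 1 δ, f i := by
    refine Finset.sum_subset (Finset.Icc_subset_Icc_right (by omega)) fun i hi hi' => hf i ?_
    rw [Finset.mem_Icc] at hi hi'
    omega
  rw [h1, ← Finset.Ico_add_one_right_eq_Icc, Finset.sum_Ico_eq_sum_range, Nat.add_sub_cancel]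
  exact Finset.sum_congr rfl fun i _ => by rw [add_comm]

/-- The generating function of `D(n, n + x)` over `n`. -/
noncomputable def diag (D : ℕ → ℕ → ℝ) (x : ℕ) : PowerSeries ℝ := PowerSeries.mk fun n => D n (n + x)

theorem IsPatternCount.one_eq (h : IsPatternCount D F a c b d δ ε) :
    1 = diag D (δ - 1) + ∑ i ∈ Finset.Icc 1 ((δ + 1) / 2), (-1) ^ i *
      (((δ - i).choose i : PowerSeries ℝ) * (PowerSeries.X ^ i * diag D (δ - 1)) +
        ((δ - i).choose (i - 1) : PowerSeries ℝ) * (PowerSeries.X ^ i * diag D δ)) := by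
  have hδ := h.one_le_δ
  -- Entry `j` stands for the diagonal of height `j - 1`; the entry `1` at `j = 0` encodes `D(n+1,n)
  -- = 0` together with the initial value `1`.
  let g : ℕ → PowerSeries ℝ := fun j => Nat.casesOn j 1 (diag D)
  have hg : ∀ j < δ, g j = g (j + 1) - PowerSeries.X * g (j + 2) := by
    intro j hj
    ext n
    cases j with
    | zero =>
      cases n with
      | zero => simp [g, diag, h.D_zero]
      | succ n =>
        have h1 := h.recurrence n n le_rfl
        rw [h.D_below, h.F_depth _ _ (by omega)] at h1
        simp only [g, diag, map_sub, PowerSeries.coeff_succ_X_mul, PowerSeries.coeff_mk]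
        simp [PowerSeries.coeff_one]
        linarith
    | succ j =>
      cases n with
      | zero => simp [g, diag, h.D_zero]
      | succ n =>
        have h1 := h.recurrence n (n + 1 + j) (by omega)
        rw [h.F_depth _ _ (by omega)] at h1
        simp only [g, diag, map_sub, PowerSeries.coeff_succ_X_mul, PowerSeries.coeff_mk]
        rw [show n + (j + 1 + 1) = n + 1 + j + 1 by omega, show n + 1 + (j + 1) = n + 1 + j + 1 by omega]
        linarith
  obtain ⟨k, rfl⟩ : ∃ k, δ = k + 1 := ⟨δ - 1, by omega⟩
  have h1 := eq_fibPoly_mul hg k 0 (by omega)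
  have h2 : (1 : PowerSeries ℝ) = fibPoly (k + 1) * diag D k -
    PowerSeries.X * fibPoly k * diag D (k + 1) := h1
  rw [sum_Icc_half_eq hδ]
  · refine h2.trans ?_
    rw [fibPoly_eq_sum_range, fibPoly_eq_sum_range, Finset.sum_range_succ', add_mul,
      Finset.sum_mul, Finset.mul_sum, Finset.sum_mul, add_sub_right_comm,
      ← Finset.sum_sub_distrib, add_comm]
    congr 1
    · simp
    · refine Finset.sum_congr rfl fun i _ => ?_
      rw [Nat.add_sub_add_right, Nat.add_sub_cancel, Nat.add_sub_cancel, neg_pow, neg_pow PowerSeries.X i]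
      ring
  · intro i hi
    rw [Nat.choose_eq_zero_of_lt (by omega), Nat.choose_eq_zero_of_lt (by omega)]
    simp

theorem commute_B₁_E (hB : ∀ v : ℝ, B * E v = E v * B) (v : ℝ) : Commute (B₁ B) (E v) :=
  (commute_E_E _ _).mul_left (hB v)

theorem exists_corr_eq_mul (hB : ∀ v : ℝ, B * E v = E v * B) (δ : ℕ) :
    ∃ K : Op, Commute K (B₁ B) ∧ corr B δ = K * B₁ B := by
  refine ⟨∑ i ∈ Finset.Icc 1 ((δ + 1) / 2),
    (((δ - i).choose i : ℝ) • (1 : Op) + ((δ - i).choose (i - 1) : ℝ) • E 1)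
      * ((-1 : ℝ) ^ i • B₁ B ^ (i - 1)), ?_, ?_⟩
  · refine Commute.sum_left _ _ _ fun i _ => Commute.mul_left (Commute.add_left ?_ ?_) ?_
    · exact (Commute.one_left _).smul_left _
    · exact (commute_B₁_E hB 1).symm.smul_left _
    · exact ((Commute.refl _).pow_left _).smul_left _
  · rw [corr, Finset.sum_mul]
    refine Finset.sum_congr rfl fun i hi => ?_
    rw [mul_assoc, smul_mul_assoc, ← pow_succ, Nat.sub_add_cancel (Finset.mem_Icc.1 hi).1]

theorem commute_corr_B₁ (hB : ∀ v : ℝ, B * E v = E v * B) (δ : ℕ) :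
    Commute (corr B δ) (B₁ B) := by
  obtain ⟨K, hK, h⟩ := exists_corr_eq_mul hB δ
  rw [h]
  exact hK.mul_left (Commute.refl _)

theorem corr_pow_eq_zero (hB : ∀ v : ℝ, B * E v = E v * B) (hs : IsSheffer B s) (δ : ℕ)
    {n N : ℕ} (h : n < N) : (corr B δ ^ N) (E n (s n)) = 0 := by
  obtain ⟨K, hK, hc⟩ := exists_corr_eq_mul hB δ
  have := (hs.B₁ hB).pow_apply N n
  rw [hc, hK.mul_pow, Module.End.mul_apply, this, if_neg (by omega), map_zero]

/-- The coefficients of `IsPatternCount.one_eq`: multiplication by the series variable becomes `B₁`,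
and `E 1` moves from height `δ - 1` to height `δ`. -/
theorem eval_one_add_corr (h : IsPatternCount D F a c b d δ ε) (hs : IsSheffer B s)
    (hD : ∀ n m : ℕ, n + δ ≤ m → D n m = (s n).eval (m : ℝ))
    (hB : ∀ v : ℝ, B * E v = E v * B) (n : ℕ) :
    ((1 + corr B δ) (E n (s n))).eval ((δ : ℝ) - 1) = if n = 0 then 1 else 0 := by
  have hδ := h.one_le_δ
  have e0 : ∀ n : ℕ, (E n (s n)).eval ((δ : ℝ) - 1) = D n (n + (δ - 1)) := by
    intro n
    rw [h.eq_eval hs hD (by omega), eval_E]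
    congr 1
    rw [Nat.cast_add, Nat.cast_sub hδ]
    push_cast
    ring
  have e1 : ∀ n : ℕ, (E n (s n)).eval ((δ : ℝ) - 1 + 1) = D n (n + δ) := by
    intro n
    rw [h.eq_eval hs hD (by omega), eval_E]
    congr 1
    push_cast
    ring
  have h1 := congrArg (PowerSeries.coeff n) h.one_eq
  rw [PowerSeries.coeff_one] at h1
  rw [h1, LinearMap.add_apply, Module.End.one_apply, eval_add, e0, map_add, map_sum, corr,
    LinearMap.sum_apply, eval_finsetSum]
  congr 1
  · simp [diag]
  · refine Finset.sum_congr rfl fun i _ => ?_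
    have h2 : ((-1 : PowerSeries ℝ) ^ i *
        (((δ - i).choose i : PowerSeries ℝ) * (PowerSeries.X ^ i * diag D (δ - 1)) +
          ((δ - i).choose (i - 1) : PowerSeries ℝ) * (PowerSeries.X ^ i * diag D δ))) =
        PowerSeries.C ((-1 : ℝ) ^ i * ((δ - i).choose i : ℝ)) *
            (PowerSeries.X ^ i * diag D (δ - 1)) +
          PowerSeries.C ((-1 : ℝ) ^ i * ((δ - i).choose (i - 1) : ℝ)) *
            (PowerSeries.X ^ i * diag D δ) := by
      simp only [map_mul, map_pow, map_neg, map_one, map_natCast]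
      ring
    have h3 := (hs.B₁ hB).pow_apply i n
    rw [h2, map_add, PowerSeries.coeff_C_mul, PowerSeries.coeff_C_mul,
      PowerSeries.coeff_X_pow_mul', PowerSeries.coeff_X_pow_mul', Module.End.mul_apply,
      LinearMap.smul_apply, h3]
    split_ifs with hi
    · simp only [LinearMap.add_apply, LinearMap.smul_apply, Module.End.one_apply, map_smul,
        eval_add, eval_smul, eval_E 1, e0, e1, smul_eq_mul, diag, PowerSeries.coeff_mk]
      ring
    · simp

theorem one_add_corr_apply (h : IsPatternCount D F a c b d δ ε) (hs : IsSheffer B s)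
    (hD : ∀ n m : ℕ, n + δ ≤ m → D n m = (s n).eval (m : ℝ))
    (hB : ∀ v : ℝ, B * E v = E v * B) (hq : IsBasic B q) (n : ℕ) :
    (1 + corr B δ) (E n (s n)) = abel q n (1 - δ) := by
  have hs1 := hs.B₁ hB
  have hcomm : ∀ f, B₁ B ((1 + corr B δ) f) = (1 + corr B δ) (B₁ B f) := fun f =>
    LinearMap.congr_fun ((Commute.one_left _).add_left (commute_corr_B₁ hB δ)).eq.symm f
  refine hs1.eq_of_eval_eq (g := fun n => (1 + corr B δ) (E n (s n)))
    (h := fun n => abel q n (1 - δ)) ?_ (fun n => ?_) (hq.B₁_abel_zero hB _)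
    (fun n => hq.B₁_abel_succ hB _ _) ((δ : ℝ) - 1) (fun n => ?_) n
  · rw [hcomm, hs1.2.1, map_zero]
  · rw [hcomm, hs1.2.2]
  · have := hq.eval_abel hB n (1 - δ)
    rw [neg_sub] at this
    rw [eval_one_add_corr h hs hD hB, this]

theorem sheffer_eq_sum (h : IsPatternCount D F a c b d δ ε) (hs : IsSheffer B s)
    (hD : ∀ n m : ℕ, n + δ ≤ m → D n m = (s n).eval (m : ℝ))
    (hB : ∀ v : ℝ, B * E v = E v * B) (hq : IsBasic B q) {n N : ℕ} (hn : n < N) :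
    E n (s n) = ∑ j ∈ Finset.range N,
      (-1 : ℝ) ^ j • (corr B δ ^ j) (abel q n (1 - δ)) := by
  have h1 := LinearMap.congr_fun (geom_sum_mul_neg (-corr B δ) N) (E n (s n))
  rw [sub_neg_eq_add, Module.End.mul_apply, one_add_corr_apply h hs hD hB hq,
    LinearMap.sub_apply, neg_pow (corr B δ) N, Module.End.mul_apply, corr_pow_eq_zero hB hs δ hn,
    map_zero, sub_zero, Module.End.one_apply, LinearMap.sum_apply] at h1
  rw [← h1]
  refine Finset.sum_congr rfl fun j _ => ?_
  rw [← neg_one_smul ℝ (corr B δ), _root_.smul_pow, LinearMap.smul_apply]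

/-! ### Existence of the operator and its sequences -/

theorem ascPochhammer_sub_shift (n : ℕ) :
    ascPochhammer ℝ (n + 1) - E (-1) (ascPochhammer ℝ (n + 1)) =
      ((n : ℝ) + 1) • ascPochhammer ℝ n := by
  have h := congrArg (E (-1)) (ascPochhammer_succ_comp_X_add_one (S := ℝ) n)
  have e : ∀ f : ℝ[X], E (-1) (f.comp (X + 1)) = f := fun f =>
    Polynomial.funext fun x => by rw [eval_E, eval_comp]; simp
  rw [map_add, map_nsmul, e, e] at h
  nth_rw 1 [h]
  rw [add_sub_cancel_left, ← Nat.cast_smul_eq_nsmul ℝ]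
  push_cast
  rfl

theorem degree_ascPochhammer (n : ℕ) : (ascPochhammer ℝ n).degree = n := by
  rw [degree_eq_natDegree (monic_ascPochhammer ℝ n).ne_zero, ascPochhammer_natDegree]

/-- The backward difference lowers rising factorials, so it is onto; it also lowers degrees, which
rules out a preimage of degree at most `k`. -/
theorem exists_sub_shift_eq {k : ℕ} {g : ℝ[X]} (hg : g.degree = k) :
    ∃ f : ℝ[X], f.degree = (k + 1 : ℕ) ∧ f - E (-1) f = g := by
  let T : Op := 1 - E (-1)
  have hT : ∀ f, T f = f - E (-1) f := fun f => rfl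
  have h1 : degreeLT ℝ (k + 1) ≤ (degreeLT ℝ (k + 2)).map T := by
    refine degreeLT_induction degree_ascPochhammer fun j hj => ?_
    refine ⟨((j : ℝ) + 1)⁻¹ • ascPochhammer ℝ (j + 1), ?_, ?_⟩
    · refine Submodule.smul_mem _ _ (mem_degreeLT.2 ?_)
      rw [degree_ascPochhammer]
      exact_mod_cast (by omega : j + 1 < k + 2)
    · rw [map_smul, hT, ascPochhammer_sub_shift, inv_smul_smul₀ (by positivity)]
  have h2 : degreeLT ℝ (k + 1) ≤ (degreeLT ℝ k).comap T := by
    refine degreeLT_induction degree_ascPochhammer fun j hj => ?_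
    rw [Submodule.mem_comap, hT]
    cases j with
    | zero => rw [ascPochhammer_zero, ← C_1, E_C, sub_self]; exact Submodule.zero_mem _
    | succ j =>
      rw [ascPochhammer_sub_shift]
      refine Submodule.smul_mem _ _ (mem_degreeLT.2 ?_)
      rw [degree_ascPochhammer]
      exact_mod_cast (by omega : j < k)
  obtain ⟨f, hf, hfg⟩ := h1 (mem_degreeLT.2 (hg.trans_lt (by exact_mod_cast k.lt_succ_self)))
  refine ⟨f, le_antisymm ?_ ?_, hfg⟩
  · have := mem_degreeLT.1 hf
    exact Order.le_of_lt_succ (by exact_mod_cast this)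
  · by_contra hlt
    have := mem_degreeLT.1 (h2 (mem_degreeLT.2 (not_le.1 hlt)))
    rw [hfg, hg] at this
    exact lt_irrefl _ this

/-! ### Polynomiality of the path counts -/

theorem E_mem_degreeLT {n : ℕ} {f : ℝ[X]} (hf : f ∈ degreeLT ℝ n) (v : ℝ) :
    E v f ∈ degreeLT ℝ n := by
  rw [mem_degreeLT, degree_E]
  exact mem_degreeLT.1 hf

/-- `F(n,·)` comes from earlier columns, and `a ≥ 2` keeps its degree below `n - 1`. Hence the
backward difference of `D(n,·)` has the degree of `D(n-1,·)`, and summation raises it by one. -/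
theorem IsPatternCount.exists_poly (h : IsPatternCount D F a c b d δ ε) (n : ℕ) :
    ∃ p f : ℝ[X], p.degree = n ∧ f ∈ degreeLT ℝ (n - 1) ∧
      ∀ m : ℕ, n + δ ≤ m → D n m = p.eval (m : ℝ) ∧ F n m = f.eval (m : ℝ) := by
  induction n using Nat.strong_induction_on with
  | _ n ih =>
    have ha := h.two_le_a
    have h0 := h.one_le_b
    have h1 := h.b_le_a
    have h2 := h.d_le_b
    have h3 := h.d_le_c
    have h4 := h.c_le_a
    obtain ⟨f, hf, hF⟩ : ∃ f ∈ degreeLT ℝ (n - 1),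
        ∀ m : ℕ, n + δ ≤ m → F n m = f.eval (m : ℝ) := by
      rcases lt_or_ge n a with hn | hn
      · exact ⟨0, Submodule.zero_mem _, fun m _ => by rw [h.F_left n m hn, eval_zero]⟩
      · obtain ⟨k, rfl⟩ : ∃ k, n = k + a := ⟨n - a, by omega⟩
        obtain ⟨p, _, hp, _, hpD⟩ := ih k (by omega)
        obtain ⟨_, f, _, hf, hfF⟩ := ih (k + a - b) (by omega)
        refine ⟨E (-c) p - ε • E (-d) f, Submodule.sub_mem _ (E_mem_degreeLT ?_ _)
          (Submodule.smul_mem _ _ (E_mem_degreeLT (degreeLT_mono (by omega) hf) _)), ?_⟩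
        · rw [mem_degreeLT, hp]
          exact_mod_cast (by omega : k < k + a - 1)
        · intro m hm
          obtain ⟨l, rfl⟩ : ∃ l, m = l + c := ⟨m - c, by omega⟩
          have e1 : ((l + c : ℕ) : ℝ) + -(d : ℝ) = ((l + c - d : ℕ) : ℝ) := by
            rw [Nat.cast_sub (by omega)]; ring
          have e2 : ((l + c : ℕ) : ℝ) + -(c : ℝ) = (l : ℝ) := by push_cast; ring
          rw [eval_sub, eval_smul, eval_E, eval_E, e1, e2, ← (hpD l (by omega)).1,
            ← (hfF (l + c - d) (by omega)).2, ← h.F_add k l (by omega), smul_eq_mul]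
          ring
    cases n with
    | zero =>
      exact ⟨1, f, by simp, hf, fun m hm => ⟨by rw [h.D_zero, eval_one], hF m hm⟩⟩
    | succ n =>
      obtain ⟨p, _, hp, _, hpD⟩ := ih n (by omega)
      have hg : (p - f).degree = n := by
        rw [degree_sub_eq_left_of_degree_lt, hp]
        rw [hp]
        simpa using mem_degreeLT.1 hf
      obtain ⟨r, hr, hrg⟩ := exists_sub_shift_eq hg
      -- The constant of summation, fitted at the lowest point of the region.
      obtain ⟨t, ht⟩ : ∃ t, t = D (n + 1) (n + 1 + δ) - r.eval ((n + 1 + δ : ℕ) : ℝ) := ⟨_, rfl⟩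
      refine ⟨r + C t, f, ?_, hf, fun m hm => ⟨?_, hF m hm⟩⟩
      · rw [degree_add_C, hr]
        rw [hr]
        exact_mod_cast n.succ_pos
      · obtain ⟨j, rfl⟩ : ∃ j, m = n + 1 + δ + j := ⟨m - (n + 1 + δ), by omega⟩
        induction j with
        | zero => rw [eval_add, eval_C, ht, add_zero]; ring
        | succ j ihj =>
          have h5 := ihj (by omega)
          have h6 := h.recurrence n (n + 1 + δ + j) (by omega)
          have h7 := congrArg (eval ((n + 1 + δ + j + 1 : ℕ) : ℝ)) hrg
          have e : ((n + 1 + δ + j + 1 : ℕ) : ℝ) + -1 = (n + 1 + δ + j : ℕ) := by push_cast; ring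
          rw [eval_sub, eval_E, e, eval_sub, ← (hpD (n + 1 + δ + j + 1) (by omega)).1,
            ← hF (n + 1 + δ + j + 1) (by omega)] at h7
          rw [eval_add, eval_C] at h5 ⊢
          rw [← add_assoc]
          linarith

/-! ### The operator of a polynomial sequence and its shift invariance -/

theorem exists_op (hs : ∀ n : ℕ, (s n).degree = n) : ∃ B : Op, IsSheffer B s := by
  let q : Polynomial.Sequence ℝ := ⟨s, hs⟩
  let β := q.basis fun i => (leadingCoeff_ne_zero.2 (q.ne_zero i)).isUnit
  have hβ : ∀ n, s n = β n := fun n => by simp [β, q]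
  refine ⟨β.constr ℝ fun n => Nat.casesOn n 0 s, hs, ?_, fun n => ?_⟩
  · rw [hβ 0]
    exact β.constr_basis ℝ _ 0
  · rw [hβ (n + 1)]
    exact β.constr_basis ℝ _ (n + 1)

theorem IsSheffer.map_mem_degreeLT (hs : IsSheffer B s) {n : ℕ} {f : ℝ[X]}
    (hf : f ∈ degreeLT ℝ (n + 1)) : B f ∈ degreeLT ℝ n := by
  have : degreeLT ℝ (n + 1) ≤ (degreeLT ℝ n).comap B := by
    refine degreeLT_induction hs.1 fun k hk => ?_
    rw [Submodule.mem_comap]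
    cases k with
    | zero => rw [hs.2.1]; exact Submodule.zero_mem _
    | succ k =>
      rw [hs.2.2, mem_degreeLT, hs.1]
      exact_mod_cast (by omega : k < n)
  exact this hf

theorem pow_mem_degreeLT {n : ℕ} (hB : ∀ f ∈ degreeLT ℝ n, B f ∈ degreeLT ℝ n) (k : ℕ)
    {f : ℝ[X]} (hf : f ∈ degreeLT ℝ n) : (B ^ k) f ∈ degreeLT ℝ n := by
  induction k with
  | zero => simpa using hf
  | succ k ih =>
    rw [pow_succ', Module.End.mul_apply]
    exact hB _ ih

/-- Induction on degree. The functional equation writes `defect B f` through `B^a f` and `B^b f`,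
which have lower degree, where commutation is known. So `B` commutes with `defect B` at `f`, and
cancelling `B` and `1` leaves `E^{-1}`. -/
theorem IsPatternCount.map_shift_neg_one (h : IsPatternCount D F a c b d δ ε) (hs : IsSheffer B s)
    (hD : ∀ n m : ℕ, n + δ ≤ m → D n m = (s n).eval (m : ℝ)) (n : ℕ) :
    ∀ f ∈ degreeLT ℝ n, B (E (-1) f) = E (-1) (B f) := by
  have ha := h.two_le_a
  have hb := h.one_le_b
  have hΦ : ∀ f, defect B f = B f + E (-1) f - f := fun f => rfl
  induction n with
  | zero =>
    intro f hf
    have : f = 0 := by simpa [mem_degreeLT] using hf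
    simp [this]
  | succ n ih =>
    have hBn : ∀ f ∈ degreeLT ℝ n, B f ∈ degreeLT ℝ n := fun f hf =>
      hs.map_mem_degreeLT (degreeLT_mono (Nat.le_succ n) hf)
    have hΦn : ∀ f ∈ degreeLT ℝ n, defect B f ∈ degreeLT ℝ n := fun f hf =>
      Submodule.sub_mem _ (Submodule.add_mem _ (hBn f hf) (E_mem_degreeLT hf _)) hf
    have hE : ∀ k : ℕ, ∀ f ∈ degreeLT ℝ n, B (E (-k) f) = E (-k) (B f) := by
      intro k
      induction k with
      | zero => intro f _; simp [E_zero]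
      | succ k ihk =>
        intro f hf
        have e : (-((k + 1 : ℕ) : ℝ)) = -1 + -k := by push_cast; ring
        rw [e, ← E_E, ← E_E, ih _ (E_mem_degreeLT hf _), ihk f hf]
    have hBΦ : ∀ f ∈ degreeLT ℝ n, B (defect B f) = defect B (B f) := by
      intro f hf
      rw [hΦ, hΦ, map_sub, map_add, ih f hf]
    have hop : ∀ f, defect B f = E (-c) ((B ^ a) f) - ε • E (-d) (defect B ((B ^ b) f)) :=
      fun f => eq_sub_of_add_eq (LinearMap.congr_fun (h.defect_op_add hs hD) f)
    intro f hf
    have hpow : ∀ k, 1 ≤ k → (B ^ k) f ∈ degreeLT ℝ n := by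
      intro k hk
      obtain ⟨k, rfl⟩ : ∃ j, k = j + 1 := ⟨k - 1, by omega⟩
      rw [pow_succ, Module.End.mul_apply]
      exact pow_mem_degreeLT hBn k (hs.map_mem_degreeLT hf)
    have hcomm : ∀ k : ℕ, (B ^ k) (B f) = B ((B ^ k) f) := fun k => by
      rw [← Module.End.mul_apply, ← Module.End.mul_apply, ← pow_succ, ← pow_succ']
    have key : B (defect B f) = defect B (B f) := by
      rw [hop f, hop (B f), map_sub, map_smul, hE _ _ (hpow a (by omega)),
        hE _ _ (hΦn _ (hpow b hb)), hBΦ _ (hpow b hb), hcomm, hcomm]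
    rw [hΦ, hΦ, map_sub, map_add] at key
    exact add_left_cancel (sub_left_injective key)

theorem E_eq_sum (v : ℝ) (f : ℝ[X]) :
    E v f = ∑ k ∈ Finset.range (f.natDegree + 1), v ^ k • hasseDeriv k f := by
  refine Polynomial.funext fun x => ?_
  have h1 : (E v f).eval x = (taylor x f).eval v := by
    rw [eval_E, taylor_eval, add_comm]
  rw [h1, eval_eq_sum_range, natDegree_taylor, eval_finsetSum]
  exact Finset.sum_congr rfl fun k _ => by
    rw [taylor_coeff, eval_smul, smul_eq_mul, mul_comm]

/-- An operator that commutes with `E^{-1}` commutes with all shifts. -/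
theorem mul_E_of_mul_E_neg_one (h : B * E (-1) = E (-1) * B) (v : ℝ) : B * E v = E v * B := by
  refine LinearMap.ext fun f => Polynomial.funext fun x => ?_
  -- By Taylor expansion `B (E w f)` at `x` is a polynomial in `w`; agreement at `w = 0, -1, -2, …`
  -- then extends to all real `w`.
  let Q : ℝ[X] := ∑ k ∈ Finset.range (f.natDegree + 1), C ((B (hasseDeriv k f)).eval x) * X ^ k
  have hQ : ∀ w : ℝ, Q.eval w = (B (E w f)).eval x := by
    intro w
    rw [E_eq_sum, map_sum, eval_finsetSum, eval_finsetSum]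
    exact Finset.sum_congr rfl fun k _ => by
      rw [eval_mul, eval_C, eval_pow, eval_X, map_smul, eval_smul, smul_eq_mul, mul_comm]
  have hcomm : ∀ k : ℕ, B * E (-k) = E (-k) * B := by
    intro k
    have : E (-k) = E (-1) ^ k := by rw [E_pow]; congr 1; ring
    rw [this]
    exact (show Commute B (E (-1)) from h).pow_right k
  have hQ' : Q.comp (-X) = (taylor x (B f)).comp (-X) := by
    refine eq_of_eval_natCast_eq 0 fun m _ => ?_
    rw [eval_comp, eval_comp, eval_neg, eval_X, hQ, ← Module.End.mul_apply, hcomm,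
      Module.End.mul_apply, eval_E, taylor_eval, add_comm]
  have := congrArg (eval (-v)) hQ'
  rw [eval_comp, eval_comp, eval_neg, eval_X, neg_neg, hQ, taylor_eval] at this
  rw [Module.End.mul_apply, Module.End.mul_apply, this, eval_E, add_comm]

/-- Convolution with constants preserves the lowering by `B`; the inverse of the series of values
`s_n(0)` normalizes the values at `0`. -/
theorem IsSheffer.exists_basic (hs : IsSheffer B s) : ∃ q, IsBasic B q := by
  obtain ⟨k, hk, hk0⟩ := hs.exists_eq_C
  let S : PowerSeries ℝ := PowerSeries.mk fun n => (s n).eval 0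
  have hS : PowerSeries.constantCoeff S ≠ 0 := by
    rw [← PowerSeries.coeff_zero_eq_constantCoeff_apply, PowerSeries.coeff_mk, hk0, eval_C]
    exact hk
  let α : ℕ → ℝ := fun n => PowerSeries.coeff n S⁻¹
  have hα : α 0 ≠ 0 := by
    change PowerSeries.coeff 0 S⁻¹ ≠ 0
    rw [PowerSeries.coeff_zero_eq_constantCoeff_apply, PowerSeries.constantCoeff_inv]
    exact inv_ne_zero hS
  refine ⟨fun n => ∑ p ∈ Finset.HasAntidiagonal.antidiagonal n, α p.1 • s p.2,
    ⟨fun n => ?_, ?_, fun n => ?_⟩, fun n => ?_⟩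
  · have h1 : (α 0 • s n).degree = n := by
      rw [smul_eq_C_mul, degree_C_mul hα, hs.1]
    cases n with
    | zero => simpa using h1
    | succ n =>
      beta_reduce
      rw [Finset.Nat.sum_antidiagonal_succ, degree_add_eq_left_of_degree_lt, h1]
      rw [h1]
      refine mem_degreeLT.1 (Submodule.sum_mem _ fun p hp => Submodule.smul_mem _ _ ?_)
      rw [mem_degreeLT, hs.1]
      have := Finset.HasAntidiagonal.mem_antidiagonal.1 hp
      exact_mod_cast (by omega : p.2 < n + 1)
  · simp [hs.2.1]
  · beta_reduce
    rw [Finset.Nat.sum_antidiagonal_succ', map_add, map_sum, map_smul, hs.2.1, smul_zero,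
      zero_add]
    exact Finset.sum_congr rfl fun p _ => by rw [map_smul, hs.2.2]
  · have h1 := congrArg (PowerSeries.coeff n) (PowerSeries.inv_mul_cancel S hS)
    rw [PowerSeries.coeff_mul, PowerSeries.coeff_one] at h1
    rw [← h1, eval_finsetSum]
    exact Finset.sum_congr rfl fun p _ => by simp [S, α]

theorem IsSheffer.map_X (hs : IsSheffer B s) : ∃ k : ℝ, k ≠ 0 ∧ B X = C k := by
  obtain ⟨k, hk, hk0⟩ := hs.exists_eq_C
  have h1 : (s 1).degree = 1 := by simpa using hs.1 1
  have h2 := eq_X_add_C_of_degree_le_one h1.le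
  have h3 : (s 1).coeff 1 ≠ 0 := coeff_ne_zero_of_eq_degree h1
  have h4 := hs.2.2 0
  rw [h2, map_add, hs.map_C, add_zero, ← smul_eq_C_mul, map_smul, hk0] at h4
  refine ⟨k / (s 1).coeff 1, div_ne_zero hk h3, ?_⟩
  rw [← inv_smul_smul₀ h3 (B X), h4, smul_C, smul_eq_mul, inv_mul_eq_div]

theorem Admissible.exists_isCountedBy {p : List Step} (hp : Admissible p) :
    ∃ (B : Op) (b s : ℕ → ℝ[X]), IsCountedBy p B b s := by
  obtain ⟨b, d, ε, h⟩ := hp.exists_isPatternCount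
  choose s f hdeg _ hD using h.exists_poly
  obtain ⟨B, hs⟩ := exists_op hdeg
  have hD' : ∀ n m : ℕ, n + depth p ≤ m → (BallotPath.D p n m : ℝ) = (s n).eval (m : ℝ) :=
    fun n m hnm => (hD n m hnm).1
  have hB := mul_E_of_mul_E_neg_one (B := B) (LinearMap.ext fun g =>
    h.map_shift_neg_one hs hD' (g.natDegree + 1) g
      (mem_degreeLT.2 (degree_le_natDegree.trans_lt (by exact_mod_cast Nat.lt_succ_self _))))
  obtain ⟨q, hq⟩ := hs.exists_basic
  exact ⟨B, q, s, ⟨hB, hs.map_X⟩, hq, hs, hD'⟩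

/-! ### The pattern `rrruuurrruu` -/

theorem depth_examplePattern : depth examplePattern = 2 := by decide

theorem eq_of_mem_bifixes_examplePattern {o : List Step} (h : o ∈ bifixes examplePattern) :
    o = [.r, .r, .r, .u, .u] := by
  obtain ⟨h0, h1, h2, h3⟩ := h
  have key : ∀ o ∈ examplePattern.inits, o ≠ [] → o ≠ examplePattern → o <:+ examplePattern →
      o = [.r, .r, .r, .u, .u] := by decide
  exact key o ((List.mem_inits _ _).2 h2) h0 h1 h3

theorem bifixes_examplePattern : bifixes examplePattern = {[.r, .r, .r, .u, .u]} := by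
  refine Set.eq_singleton_iff_unique_mem.2 ⟨?_, fun o => eq_of_mem_bifixes_examplePattern⟩
  exact mem_bifixes (o := [.r, .r, .r, .u, .u]) (p' := [.u]) (by simp)

theorem admissible_examplePattern : Admissible examplePattern where
  one_le_depth := by rw [depth_examplePattern]; norm_num
  bifixIndex_le := by
    right
    rw [bifixIndex, bifixes_examplePattern, Set.ncard_singleton]
  two_le_numR := by decide
  numU_le_numR := by decide
  bifix_dim := by
    intro o p' ho h
    -- The only bifix is `rrruu`, which forces `p' = u`.
    have := eq_of_mem_bifixes_examplePattern (h ▸ mem_bifixes ho)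
    subst this
    have h1 : [.r, .r, .r, .u, .u, .u] = [.r, .r, .r, .u, .u] ++ p' := List.append_cancel_right h
    rw [← h1]
    decide

theorem corr_two_pow (hB : ∀ v : ℝ, B * E v = E v * B) (j : ℕ) :
    (-1 : ℝ) ^ j • corr B 2 ^ j = (1 + E 1) ^ j * B₁ B ^ j := by
  have h1 : (-1 : ℝ) • corr B 2 = (1 + E 1) * B₁ B := by
    simp [corr]
  have h2 : Commute (1 + E 1) (B₁ B) :=
    (Commute.one_left _).add_left (commute_B₁_E hB 1).symm
  rw [← _root_.smul_pow, h1, h2.mul_pow]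

theorem one_add_E_pow_abel (hB : ∀ v : ℝ, B * E v = E v * B) (hq : IsBasic B q) (k j : ℕ) :
    ((1 + E 1) ^ k) (abel q j (-1)) =
      ∑ i ∈ Finset.range (k + 1), (k.choose i : ℝ) • abel q j ((i : ℝ) - 1) := by
  rw [add_comm, (Commute.one_right (E 1)).add_pow, LinearMap.sum_apply]
  refine Finset.sum_congr rfl fun i _ => ?_
  rw [one_pow, mul_one, E_pow, mul_one, ← Nat.cast_comm, ← nsmul_eq_mul, LinearMap.smul_apply,
    hq.E_abel hB, ← Nat.cast_smul_eq_nsmul ℝ, neg_add_eq_sub]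

/-- Reindex by `j ↦ n - j`; the new term `j = 0` is a full row of binomial coefficients and gives
`2^n`. -/
theorem sum_one_add_E_pow_abel (hB : ∀ v : ℝ, B * E v = E v * B) (hq : IsBasic B q) (n : ℕ) :
    ∑ j ∈ Finset.range (n + 1), ((1 + E 1) ^ j * B₁ B ^ j) (abel q n (-1)) =
      C ((2 : ℝ) ^ n) + ∑ j ∈ Finset.Icc 1 n, ∑ i ∈ Finset.range (n - j + 1),
        ((n - j).choose i : ℝ) • abel q j ((i : ℝ) - 1) := by
  have h1 : ∀ j ∈ Finset.range (n + 1), ((1 + E 1) ^ j * B₁ B ^ j) (abel q n (-1)) =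
      ∑ i ∈ Finset.range (j + 1), (j.choose i : ℝ) • abel q (n - j) ((i : ℝ) - 1) := by
    intro j hj
    rw [Finset.mem_range] at hj
    rw [Module.End.mul_apply, hq.B₁_pow_abel hB, if_pos (by omega), one_add_E_pow_abel hB hq]
  rw [Finset.sum_congr rfl h1, ← Finset.sum_range_reflect, Finset.range_eq_Ico,
    Finset.sum_eq_sum_Ico_succ_bot (Nat.succ_pos n)]
  congr 1
  · simp only [hq.abel_zero hB, Nat.add_sub_cancel, Nat.sub_zero, Nat.sub_self]
    rw [← Finset.sum_smul, ← Nat.cast_sum, Nat.sum_range_choose, smul_eq_C_mul, mul_one]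
    push_cast
    rfl
  · rw [zero_add, Nat.succ_eq_add_one, Finset.Ico_add_one_right_eq_Icc]
    refine Finset.sum_congr rfl fun j hj => ?_
    rw [Finset.mem_Icc] at hj
    rw [show n + 1 - 1 - j = n - j by omega, show n - (n - j) = j by omega]

end BallotPath

theorem mainTheorem6 :
    (∀ p : List BallotPath.Step, BallotPath.Admissible p →
      -- there is a Sheffer sequence that counts weakly above `y = x + depth p`
      (∃ (B : BallotPath.Op) (b s : ℕ → Polynomial ℝ), BallotPath.IsCountedBy p B b s) ∧
      ∀ (B : BallotPath.Op) (b s : ℕ → Polynomial ℝ), BallotPath.IsCountedBy p B b s →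
        -- the operator form of the recursion, for bifix index 0 and 1
        (BallotPath.bifixIndex p = 0 →
          1 - B - BallotPath.E (-1) =
            -(B ^ BallotPath.numR p * BallotPath.E (-(BallotPath.numU p : ℝ)))) ∧
        (∀ o p' : List BallotPath.Step, o ≠ [] → p = o ++ p' ++ o →
          (1 - B - BallotPath.E (-1)) *
              (1 + B ^ BallotPath.numR (o ++ p') *
                BallotPath.E (-(BallotPath.numU (o ++ p') : ℝ))) =
            -(B ^ BallotPath.numR p * BallotPath.E (-(BallotPath.numU p : ℝ)))) ∧
        -- `s_n(n + x)` agrees with the path counts exactly for `x ≥ depth p - 1`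
        (∀ x : ℕ,
          (∀ n : ℕ, (BallotPath.D p n (n + x) : ℝ) = (s n).eval ((n : ℝ) + x)) ↔
            BallotPath.depth p ≤ x + 1) ∧
        -- the expansion of `s_n(n + x)`; the terms with `j > n` vanish
        (∀ n N : ℕ, n < N →
          BallotPath.E n (s n) =
            ∑ j ∈ Finset.range N, (-1 : ℝ) ^ j •
              (BallotPath.corr B (BallotPath.depth p) ^ j)
                (BallotPath.abel b n (1 - (BallotPath.depth p : ℝ)))) ∧
        -- the powers of `B₁` on the polynomials in this expansion
        (∀ n k : ℕ,
          (BallotPath.B₁ B ^ k) (BallotPath.abel b n (1 - (BallotPath.depth p : ℝ))) =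
            if k ≤ n then BallotPath.abel b (n - k) (1 - (BallotPath.depth p : ℝ)) else 0)) ∧
    -- the pattern `rrruuurrruu`
    BallotPath.Admissible BallotPath.examplePattern ∧
    BallotPath.depth BallotPath.examplePattern = 2 ∧
    ∀ (B : BallotPath.Op) (b s : ℕ → Polynomial ℝ),
      BallotPath.IsCountedBy BallotPath.examplePattern B b s →
        (∀ n N : ℕ, n < N →
          BallotPath.E n (s n) =
            ∑ j ∈ Finset.range N,
              ((1 + BallotPath.E 1) ^ j * BallotPath.B₁ B ^ j) (BallotPath.abel b n (-1))) ∧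
        ∀ n : ℕ,
          BallotPath.E n (s n) =
            Polynomial.C ((2 : ℝ) ^ n) +
              ∑ j ∈ Finset.Icc 1 n, ∑ i ∈ Finset.range (n - j + 1),
                ((n - j).choose i : ℝ) • BallotPath.abel b j ((i : ℝ) - 1) := by
  refine ⟨fun p hp => ⟨hp.exists_isCountedBy, ?_⟩, BallotPath.admissible_examplePattern,
    BallotPath.depth_examplePattern, ?_⟩
  · rintro B q s ⟨⟨hB, -⟩, hq, hs, hD⟩
    obtain ⟨b, d, ε, h⟩ := hp.exists_isPatternCount
    refine ⟨fun h0 => ?_, ?_, h.forall_eq_eval_iff hs hD,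
      fun n N hn => BallotPath.sheffer_eq_sum h hs hD hB hq hn,
      fun n k => hq.B₁_pow_abel hB n k _⟩
    · simpa using (hp.isPatternCount_zero h0).op_eq hs hD hB
    · rintro o p' ho rfl
      simpa using (BallotPath.Admissible.isPatternCount_one ho hp).op_eq hs hD hB
  · rintro B q s ⟨⟨hB, -⟩, hq, hs, hD⟩
    obtain ⟨b, d, ε, h⟩ := BallotPath.admissible_examplePattern.exists_isPatternCount
    have key : ∀ n N : ℕ, n < N → BallotPath.E n (s n) = ∑ j ∈ Finset.range N,
        ((1 + BallotPath.E 1) ^ j * BallotPath.B₁ B ^ j) (BallotPath.abel q n (-1)) := by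
      intro n N hn
      rw [BallotPath.sheffer_eq_sum h hs hD hB hq hn, BallotPath.depth_examplePattern]
      refine Finset.sum_congr rfl fun j _ => ?_
      rw [← BallotPath.corr_two_pow hB, LinearMap.smul_apply]
      norm_num
    refine ⟨key, fun n => ?_⟩
    rw [key n (n + 1) n.lt_succ_self, BallotPath.sum_one_add_E_pow_abel hB hq]
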